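/- Let $d\in\mathbb N$, $\beta>0$, and let $V\in C^2(\mathbb R^d;\mathbb R)$ with $Z=\int_{\mathbb R^d}e^{-\beta V}\,dx<\infty$; put $\rho^*=Z^{-1}e^{-\beta V}$. Let $\rho_0>0$ be a probability density on $\mathbb R^d$, put $V_0=-\beta^{-1}\log\rho_0$, and for $T>0$ let $$\rho_T(x)=\mathrm{Prox}_{T,V}(\rho_0)(x)=\int_{\mathbb R^d}\frac{\exp\left[-\frac{\beta}{2}\left(V(x)+\frac{\|x-y\|_2^2}{2T}\right)\right]}{\int_{\mathbb R^d}\exp\left[-\frac{\beta}{2}\left(V(z)+\frac{\|z-y\|_2^2}{2T}\right)\right]dz}\,\rho_0(y)\,dy .$$ Fix $x\in\mathbb R^d$ and assume that $V$ and $\rho_0$ (equivalently $V$ and $V_0$) are four times continuously differentiable in a neighbourhood of $x$. Then for every $T>0$ all integrals in the definition of $\rho_T(x)$ converge, and there is a constant $C$, independent of $T$, such that for every $T>0$ the following identities hold with error terms bounded by $CT^2$ in absolute value: $$\rho_T(x)=\rho_0(x)\left[1-\beta T\,\nabla(V-V_0)(x)\cdot\nabla V_0(x)+T\,\Delta(V-V_0)(x)\right]+\mathcal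 O(T^2),$$ $$\rho_T(x)=\rho_0(x)+T\beta^{-1}\,\nabla\cdot\left(\rho_0\nabla\log\frac{\rho_0}{\rho^*}\right)(x)+\mathcal O(T^2).$$ Moreover, with the same $C$: if $\rho(t_0,\cdot)=\rho_0$ for a function $\rho(t,y)$ that satisfies the Fokker–Planck equation $\partial_t\rho=\nabla\cdot(\rho\nabla V)+\beta^{-1}\Delta\rho$ at time $t_0$ and at the point $x$ (with $\partial_t$ the right derivative, so that $t_0$ may be the initial time), then for every $T>0$ $$\rho_T(x)=\rho_0(x)+T\,\partial_t\rho(t_0,x)+\mathcal O(T^2).$$ -/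

import Mathlib

open MeasureTheory
open scoped Gradient Laplacian

/-- The Gibbs density `ρ* = Z⁻¹ exp (-β V)`, with `Z = ∫ exp (-β V)`. -/
noncomputable def gibbsDensity {d : ℕ} (β : ℝ) (V : EuclideanSpace ℝ (Fin d) → ℝ)
    (x : EuclideanSpace ℝ (Fin d)) : ℝ :=
  (∫ z, Real.exp (-β * V z))⁻¹ * Real.exp (-β * V x)

/-- The potential `V₀ = -β⁻¹ log ρ₀` of a positive density `ρ₀`. -/
noncomputable def densityPotential {d : ℕ} (β : ℝ) (ρ₀ : EuclideanSpace ℝ (Fin d) → ℝ)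
    (x : EuclideanSpace ℝ (Fin d)) : ℝ :=
  -β⁻¹ * Real.log (ρ₀ x)

/-- The unnormalized kernel `exp (-(β/2) (V z + ‖z - y‖² / (2T)))`. -/
noncomputable def proxWeight {d : ℕ} (β T : ℝ) (V : EuclideanSpace ℝ (Fin d) → ℝ)
    (z y : EuclideanSpace ℝ (Fin d)) : ℝ :=
  Real.exp (-(β / 2) * (V z + ‖z - y‖ ^ 2 / (2 * T)))

/-- The integrand of the kernel formula, as a function of `y` for fixed `x`. -/
noncomputable def proxIntegrand {d : ℕ} (β T : ℝ) (V ρ₀ : EuclideanSpace ℝ (Fin d) → ℝ)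
    (x y : EuclideanSpace ℝ (Fin d)) : ℝ :=
  proxWeight β T V x y / (∫ z, proxWeight β T V z y) * ρ₀ y

/-- The kernel formula `Prox_{T,V}(ρ₀)` of the regularized Wasserstein proximal operator. -/
noncomputable def regWassersteinProx {d : ℕ} (β T : ℝ) (V ρ₀ : EuclideanSpace ℝ (Fin d) → ℝ)
    (x : EuclideanSpace ℝ (Fin d)) : ℝ :=
  ∫ y, proxIntegrand β T V ρ₀ x y

/-- The divergence `∑ i, ∂ᵢ Fᵢ` of a vector field on `ℝᵈ`. -/
noncomputable def divergence {d : ℕ} (F : EuclideanSpace ℝ (Fin d) → EuclideanSpace ℝ (Fin d))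
    (x : EuclideanSpace ℝ (Fin d)) : ℝ :=
  ∑ i, fderiv ℝ (fun y => F y i) x (EuclideanSpace.single i 1)

/-- The curve of densities `ρ` satisfies the Fokker-Planck equation
`∂ₜ ρ = ∇ · (ρ ∇V) + β⁻¹ Δ ρ` at time `t₀` and at the point `x`. The time derivative is taken
from the right, so that `t₀` may be the initial time. -/
def SatisfiesFokkerPlanckAt {d : ℕ} (β : ℝ) (V : EuclideanSpace ℝ (Fin d) → ℝ)
    (ρ : ℝ → EuclideanSpace ℝ (Fin d) → ℝ) (t₀ : ℝ) (x : EuclideanSpace ℝ (Fin d)) : Prop :=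
  HasDerivWithinAt (fun t => ρ t x)
    (divergence (fun y => ρ t₀ y • ∇ V y) x + β⁻¹ * Δ (ρ t₀) x) (Set.Ici t₀) t₀

/-!
With `φ = exp (-(β / 2) V)` and `a = β / (4 T)`, the proximal operator is the kernel average
`ρ_T(x) = ∫ k(x, y) ρ₀ y dy`, `k(x, y) = φ x exp (-a ‖x - y‖²) / D y`, where
`D y = ∫ φ z exp (-a ‖z - y‖²) dz`, and `T → 0` means `a → ∞`. The expansion is Laplace's method
applied twice. Writing `N = (π / a) ^ (d / 2)` for the mass of the Gaussian, the inner application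
gives `D = N (φ + Δφ / (4 a) + O(a⁻²))` uniformly near `x` (`exists_gaussianAverage_expansion`).
Inverting this and applying the method again to `ρ₀ / φ` (to second order) and to
`ρ₀ Δφ / φ²` (to leading order) gives
`ρ_T(x) = ρ₀ x + (φ Δ(ρ₀ / φ) - ρ₀ Δφ / φ)(x) / (4 a) + O(a⁻²)`
(`exists_setIntegral_transitionKernel_expansion`).

The Taylor remainders come from symmetric second differences, so that odd-order terms never appear,
and the second moments of the Gaussian from an integration by parts.

No growth condition on `V` is available, so the part of the integral away from `x` is controlled by
the denominator: `D y` is at least its part over a small ball lying closer to `y` than `x` does,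
hence `k(x, y) = O(exp (-c a))` uniformly in `y` away from `x` (`exists_transitionKernel_le`). The
same estimate bounds `k` uniformly in `y` for each `a`, which gives integrability of the kernel
formula, and uniformly for bounded `a`, which makes the error bound valid for all `T > 0` and not
only for small `T`. Square-integrability of `φ`, that is `Z < ∞`, makes `D` finite and its tail
negligible.

Finally `φ Δ(ρ₀ / φ) - ρ₀ Δφ / φ = β (∇ · (ρ₀ ∇V) + β⁻¹ Δρ₀)` at `x` (`kernelGenerator_exp`),
and the first-order coefficients in the theorem are rewritten to the same expression by computing
second directional derivatives.
-/

/-! ### Taylor bounds for symmetric second differences -/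

/-- If `y` is within `ε / 2` of `x`, so are `y ± w` within `ε` for `‖w‖ < ε / 2`. -/
lemma add_mem_ball_and_sub_mem_ball {E : Type*} [SeminormedAddCommGroup E] {x y w : E}
    {ε : ℝ} (hy : y ∈ Metric.ball x (ε / 2)) (hw : ‖w‖ < ε / 2) :
    y + w ∈ Metric.ball x ε ∧ y - w ∈ Metric.ball x ε := by
  rw [Metric.mem_ball, dist_eq_norm] at hy
  rw [Metric.mem_ball, dist_eq_norm, Metric.mem_ball, dist_eq_norm]
  constructor
  · calc ‖y + w - x‖ = ‖(y - x) + w‖ := by congr 1; abel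
      _ ≤ ‖y - x‖ + ‖w‖ := norm_add_le _ _
      _ < ε := by linarith
  · calc ‖y - w - x‖ = ‖(y - x) - w‖ := by congr 1; abel
      _ ≤ ‖y - x‖ + ‖w‖ := norm_sub_le _ _
      _ < ε := by linarith

section SecondDifference

variable {E F : Type*} [NormedAddCommGroup E] [NormedSpace ℝ E]
  [NormedAddCommGroup F] [NormedSpace ℝ F]

/-- Integrating a bound on the derivative: a map vanishing at `0` whose derivative is
`O(‖w‖ ^ n)` is itself `O(‖w‖ ^ (n + 1))`, with the same constant. -/
lemma norm_le_mul_pow_succ_of_hasFDerivAt {G : E → F} {G' : E → E →L[ℝ] F} {n : ℕ} {C δ : ℝ}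
    (hG : ∀ w, ‖w‖ < δ → HasFDerivAt G (G' w) w) (h0 : G 0 = 0) (hC : 0 ≤ C)
    (hb : ∀ w, ‖w‖ < δ → ‖G' w‖ ≤ C * ‖w‖ ^ n) {w : E} (hw : ‖w‖ < δ) :
    ‖G w‖ ≤ C * ‖w‖ ^ (n + 1) := by
  have h := (convex_closedBall (0 : E) ‖w‖).norm_image_sub_le_of_norm_hasFDerivWithin_le
    (f := G) (f' := G') (C := C * ‖w‖ ^ n) (x := 0) (y := w)
    (fun v hv => (hG v ((mem_closedBall_zero_iff.1 hv).trans_lt hw)).hasFDerivWithinAt)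
    (fun v hv => by
      have hv' := mem_closedBall_zero_iff.1 hv
      exact (hb v (hv'.trans_lt hw)).trans (by gcongr))
    (by simp) (by simp)
  simpa [h0, pow_succ, mul_assoc] using h

/-- Second differences of a map that is `C²` at `x` are quadratically small, uniformly for base
points near `x`. -/
lemma ContDiffAt.exists_second_difference_le {f : E → F} {x : E} (hf : ContDiffAt ℝ 2 f x) :
    ∃ δ > 0, ∃ C, 0 ≤ C ∧ ∀ y ∈ Metric.ball x δ, ∀ w, ‖w‖ < δ →
      ‖f (y + w) + f (y - w) - (2 : ℝ) • f y‖ ≤ C * ‖w‖ ^ 2 := by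
  obtain ⟨K, t, ht, hK⟩ := (hf.fderiv_right (m := 1) (by norm_num)).exists_lipschitzOnWith
  replace ht : ∀ᶠ y in nhds x, y ∈ t := ht
  obtain ⟨ε, hε, hball⟩ := Metric.eventually_nhds_iff_ball.1
    (ht.and (hf.eventually (by simp)))
  refine ⟨ε / 2, by positivity, 2 * K, by positivity, fun y hy w hw => ?_⟩
  have hmem := fun (w : E) (hw : ‖w‖ < ε / 2) => add_mem_ball_and_sub_mem_ball hy hw
  refine norm_le_mul_pow_succ_of_hasFDerivAt (δ := ε / 2) (n := 1)
    (G := fun w => f (y + w) + f (y - w) - (2 : ℝ) • f y)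
    (G' := fun w => fderiv ℝ f (y + w) - fderiv ℝ f (y - w)) ?_ ?_ (by positivity) ?_ hw
  · intro w hw
    obtain ⟨h1, h2⟩ := hmem w hw
    have d1 := ((hball _ h1).2.differentiableAt (by norm_num)).hasFDerivAt.comp w
      ((hasFDerivAt_id w).const_add y)
    have d2 := ((hball _ h2).2.differentiableAt (by norm_num)).hasFDerivAt.comp w
      ((hasFDerivAt_id w).const_sub y)
    refine ((d1.add d2).sub_const _).congr_fderiv ?_
    ext v
    simp [sub_eq_add_neg]
  · simp [two_smul]
  · intro w hw
    obtain ⟨h1, h2⟩ := hmem w hw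
    refine (hK.norm_sub_le (hball _ h1).1 (hball _ h2).1).trans ?_
    have : y + w - (y - w) = (2 : ℝ) • w := by rw [two_smul]; abel
    rw [this, norm_smul]
    simp only [Real.norm_ofNat, pow_one]
    linarith

/-- Fourth-order version of the Taylor formula for second differences: for `f` of class `C⁴` at
`x`, uniformly for base points near `x`. -/
lemma ContDiffAt.exists_second_difference_sub_le {f : E → F} {x : E} (hf : ContDiffAt ℝ 4 f x) :
    ∃ δ > 0, ∃ C, 0 ≤ C ∧ ∀ y ∈ Metric.ball x δ, ∀ w, ‖w‖ < δ →
      ‖f (y + w) + f (y - w) - (2 : ℝ) • f y - fderiv ℝ (fderiv ℝ f) y w w‖ ≤ C * ‖w‖ ^ 4 := by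
  have hf1 : ContDiffAt ℝ 3 (fderiv ℝ f) x := hf.fderiv_right (by norm_num)
  have hf2 : ContDiffAt ℝ 2 (fderiv ℝ (fderiv ℝ f)) x := hf1.fderiv_right (by norm_num)
  -- the second derivative of the remainder in `w` is a second difference of `D²f`
  obtain ⟨δ, hδ, C, hC, hdiff⟩ := hf2.exists_second_difference_le
  obtain ⟨ε, hε, hball⟩ := Metric.eventually_nhds_iff_ball.1
    ((hf1.eventually (by simp)).and (hf.eventually (by simp)))
  refine ⟨min δ (ε / 2), by positivity, C, hC, fun y hy w hw => ?_⟩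
  have hyδ : y ∈ Metric.ball x δ := Metric.ball_subset_ball (min_le_left _ _) hy
  have hyε : y ∈ Metric.ball x (ε / 2) := Metric.ball_subset_ball (min_le_right _ _) hy
  have hmem := fun (w : E) (hw : ‖w‖ < min δ (ε / 2)) =>
    add_mem_ball_and_sub_mem_ball hyε (hw.trans_le (min_le_right _ _))
  have hyb : y ∈ Metric.ball x ε := Metric.ball_subset_ball (by linarith) hyε
  have hsymm : ∀ v w, fderiv ℝ (fderiv ℝ f) y v w = fderiv ℝ (fderiv ℝ f) y w v := fun v w =>
    ((hball _ hyb).2.isSymmSndFDerivAt (by simp; norm_num)).eq v w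
  have step1 : ∀ w, ‖w‖ < min δ (ε / 2) → ‖fderiv ℝ f (y + w) - fderiv ℝ f (y - w)
      - (2 : ℝ) • fderiv ℝ (fderiv ℝ f) y w‖ ≤ C * ‖w‖ ^ 3 := by
    intro w hw
    refine norm_le_mul_pow_succ_of_hasFDerivAt (δ := min δ (ε / 2)) (n := 2)
      (G := fun w => fderiv ℝ f (y + w) - fderiv ℝ f (y - w)
        - (2 : ℝ) • fderiv ℝ (fderiv ℝ f) y w)
      (G' := fun w => fderiv ℝ (fderiv ℝ f) (y + w) + fderiv ℝ (fderiv ℝ f) (y - w)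
        - (2 : ℝ) • fderiv ℝ (fderiv ℝ f) y) ?_ ?_ hC ?_ hw
    · intro w hw
      obtain ⟨h1, h2⟩ := hmem w hw
      have d1 := ((hball _ h1).1.differentiableAt (by norm_num)).hasFDerivAt.comp w
        ((hasFDerivAt_id w).const_add y)
      have d2 := ((hball _ h2).1.differentiableAt (by norm_num)).hasFDerivAt.comp w
        ((hasFDerivAt_id w).const_sub y)
      refine ((d1.sub d2).sub
        ((fderiv ℝ (fderiv ℝ f) y).hasFDerivAt.const_smul (2 : ℝ))).congr_fderiv ?_
      ext v
      simp [sub_eq_add_neg]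
    · simp
    · exact fun w hw => hdiff y hyδ w (hw.trans_le (min_le_left _ _))
  refine norm_le_mul_pow_succ_of_hasFDerivAt (δ := min δ (ε / 2)) (n := 3)
    (G := fun w => f (y + w) + f (y - w) - (2 : ℝ) • f y - fderiv ℝ (fderiv ℝ f) y w w)
    (G' := fun w => fderiv ℝ f (y + w) - fderiv ℝ f (y - w)
      - (2 : ℝ) • fderiv ℝ (fderiv ℝ f) y w) ?_ ?_ hC step1 hw
  · intro w hw
    obtain ⟨h1, h2⟩ := hmem w hw
    have d1 := ((hball _ h1).2.differentiableAt (by norm_num)).hasFDerivAt.comp w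
      ((hasFDerivAt_id w).const_add y)
    have d2 := ((hball _ h2).2.differentiableAt (by norm_num)).hasFDerivAt.comp w
      ((hasFDerivAt_id w).const_sub y)
    refine (((d1.add d2).sub_const _).sub
      ((fderiv ℝ (fderiv ℝ f) y).hasFDerivAt.clm_apply (hasFDerivAt_id w))).congr_fderiv ?_
    ext v
    simp [two_smul, hsymm v w, sub_eq_add_neg]
  · simp [two_smul]

end SecondDifference

/-! ### Gaussian moments -/

section Gaussian

variable {d : ℕ}

/-- The total mass `∫ exp (-a ‖w‖²) dw` of the Gaussian weight on `ℝᵈ`. -/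
noncomputable def gaussianMass (d : ℕ) (a : ℝ) : ℝ :=
  ∫ w : EuclideanSpace ℝ (Fin d), Real.exp (-a * ‖w‖ ^ 2)

/-- The unnormalized Gaussian average `∫ g z exp (-a ‖z - y‖²) dz` of `g` around `y`. -/
noncomputable def gaussianAverage (a : ℝ) (g : EuclideanSpace ℝ (Fin d) → ℝ)
    (y : EuclideanSpace ℝ (Fin d)) : ℝ :=
  ∫ z, g z * Real.exp (-a * ‖z - y‖ ^ 2)

lemma gaussianMass_pos {a : ℝ} (ha : 0 < a) : 0 < gaussianMass d a := by
  rw [gaussianMass, GaussianFourier.integral_rexp_neg_mul_sq_norm ha]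
  positivity

lemma integrable_gaussian {a : ℝ} (ha : 0 < a) :
    Integrable (fun w : EuclideanSpace ℝ (Fin d) => Real.exp (-a * ‖w‖ ^ 2)) := by
  by_contra h
  exact (gaussianMass_pos (d := d) ha).ne' (integral_undef h)

lemma gaussianMass_half {a : ℝ} (ha : 0 < a) :
    gaussianMass d (a / 2) = 2 ^ ((d : ℝ) / 2) * gaussianMass d a := by
  rw [gaussianMass, gaussianMass, GaussianFourier.integral_rexp_neg_mul_sq_norm ha,
    GaussianFourier.integral_rexp_neg_mul_sq_norm (half_pos ha), finrank_euclideanSpace_fin,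
    ← Real.mul_rpow (by positivity) (by positivity)]
  congr 1
  field_simp

/-- Half of the exponent of the Gaussian absorbs any even power of the norm. -/
lemma norm_pow_mul_gaussian_le {a : ℝ} (ha : 0 < a) (k : ℕ) (w : EuclideanSpace ℝ (Fin d)) :
    ‖w‖ ^ (2 * k) * Real.exp (-a * ‖w‖ ^ 2)
      ≤ (k.factorial * (2 / a) ^ k) * Real.exp (-(a / 2) * ‖w‖ ^ 2) := by
  have h := Real.pow_div_factorial_le_exp (x := a / 2 * ‖w‖ ^ 2) (by positivity) k
  have hk : (0 : ℝ) < k.factorial := by positivity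
  rw [div_le_iff₀ hk, mul_pow, ← pow_mul] at h
  have h2 : ‖w‖ ^ (2 * k) ≤ k.factorial * (2 / a) ^ k * Real.exp (a / 2 * ‖w‖ ^ 2) := by
    have : (2 / a) ^ k * (a / 2) ^ k = 1 := by
      rw [← mul_pow]; field_simp; simp
    calc ‖w‖ ^ (2 * k) = (2 / a) ^ k * ((a / 2) ^ k * ‖w‖ ^ (2 * k)) := by
          rw [← mul_assoc, this, one_mul]
      _ ≤ (2 / a) ^ k * (Real.exp (a / 2 * ‖w‖ ^ 2) * k.factorial) := by gcongr
      _ = _ := by ring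
  calc _ ≤ (k.factorial * (2 / a) ^ k * Real.exp (a / 2 * ‖w‖ ^ 2))
        * Real.exp (-a * ‖w‖ ^ 2) := by gcongr
    _ = _ := by rw [mul_assoc, ← Real.exp_add]; ring_nf

lemma integrable_norm_pow_mul_gaussian {a : ℝ} (ha : 0 < a) (k : ℕ) :
    Integrable (fun w : EuclideanSpace ℝ (Fin d) =>
      ‖w‖ ^ (2 * k) * Real.exp (-a * ‖w‖ ^ 2)) := by
  refine ((integrable_gaussian (half_pos ha)).const_mul (k.factorial * (2 / a) ^ k)).mono'
    (by fun_prop) (.of_forall fun w => ?_)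
  rw [Real.norm_of_nonneg (by positivity)]
  exact norm_pow_mul_gaussian_le ha k w

/-- The `2k`-th absolute moment of the Gaussian is `O(a ^ (-k))` relative to its mass. -/
lemma integral_norm_pow_mul_gaussian_le {a : ℝ} (ha : 0 < a) (k : ℕ) :
    ∫ w : EuclideanSpace ℝ (Fin d), ‖w‖ ^ (2 * k) * Real.exp (-a * ‖w‖ ^ 2)
      ≤ (k.factorial * (2 / a) ^ k * 2 ^ ((d : ℝ) / 2))
        * gaussianMass d a := by
  rw [mul_assoc, ← gaussianMass_half ha, gaussianMass, ← integral_const_mul]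
  exact integral_mono (integrable_norm_pow_mul_gaussian ha k)
    ((integrable_gaussian (half_pos ha)).const_mul _) (norm_pow_mul_gaussian_le ha k)

/-- Second moments of the Gaussian, by integration by parts. -/
lemma integral_apply_mul_inner_mul_gaussian {a : ℝ} (ha : 0 < a)
    (L : EuclideanSpace ℝ (Fin d) →L[ℝ] ℝ) (v : EuclideanSpace ℝ (Fin d)) :
    Integrable (fun w : EuclideanSpace ℝ (Fin d) =>
      L w * inner ℝ w v * Real.exp (-a * ‖w‖ ^ 2)) ∧
    ∫ w : EuclideanSpace ℝ (Fin d), L w * inner ℝ w v * Real.exp (-a * ‖w‖ ^ 2)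
      = L v / (2 * a) * gaussianMass d a := by
  have hderiv : ∀ w : EuclideanSpace ℝ (Fin d),
      fderiv ℝ (fun w : EuclideanSpace ℝ (Fin d) => Real.exp (-a * ‖w‖ ^ 2)) w v
        = -(2 * a) * (inner ℝ w v * Real.exp (-a * ‖w‖ ^ 2)) := by
    intro w
    rw [(((hasStrictFDerivAt_norm_sq w).hasFDerivAt.const_mul (-a)).exp).fderiv]
    simp
    ring
  have hint : Integrable (fun w : EuclideanSpace ℝ (Fin d) =>
      L w * inner ℝ w v * Real.exp (-a * ‖w‖ ^ 2)) := by
    refine ((integrable_norm_pow_mul_gaussian ha 1).const_mul (‖L‖ * ‖v‖)).mono'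
      (by fun_prop) (.of_forall fun w => ?_)
    rw [norm_mul, norm_mul, Real.norm_of_nonneg (Real.exp_pos _).le]
    calc ‖L w‖ * ‖inner ℝ w v‖ * Real.exp (-a * ‖w‖ ^ 2)
        ≤ (‖L‖ * ‖w‖) * (‖w‖ * ‖v‖) * Real.exp (-a * ‖w‖ ^ 2) := by
          gcongr
          · exact L.le_opNorm w
          · exact norm_inner_le_norm w v
      _ = _ := by ring
  have hint1 : Integrable (fun w : EuclideanSpace ℝ (Fin d) =>
      L w * Real.exp (-a * ‖w‖ ^ 2)) := by
    refine (((integrable_gaussian ha).add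
      (integrable_norm_pow_mul_gaussian ha 1)).const_mul ‖L‖).mono'
      (by fun_prop) (.of_forall fun w => ?_)
    rw [norm_mul, Real.norm_of_nonneg (Real.exp_pos _).le]
    have h1 : ‖w‖ ≤ 1 + ‖w‖ ^ 2 := by nlinarith [sq_nonneg (‖w‖ - 1)]
    calc ‖L w‖ * Real.exp (-a * ‖w‖ ^ 2)
        ≤ (‖L‖ * (1 + ‖w‖ ^ 2)) * Real.exp (-a * ‖w‖ ^ 2) := by
          gcongr
          exact (L.le_opNorm w).trans (by gcongr)
      _ = _ := by simp; ring
  refine ⟨hint, ?_⟩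
  have h := integral_mul_fderiv_eq_neg_fderiv_mul_of_integrable
    (μ := (volume : Measure (EuclideanSpace ℝ (Fin d)))) (f := L)
    (g := fun w => Real.exp (-a * ‖w‖ ^ 2)) (v := v)
    (by simpa using (integrable_gaussian ha).const_mul (L v))
    (by
      simp only [hderiv]
      convert hint.const_mul (-(2 * a)) using 2 with w
      ring)
    hint1 (fun w _ => L.differentiableAt) (fun w _ => by
      exact (((hasStrictFDerivAt_norm_sq w).hasFDerivAt.const_mul (-a)).exp).differentiableAt)
  simp only [hderiv, ContinuousLinearMap.fderiv, integral_const_mul] at h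
  have h3 : ∫ w : EuclideanSpace ℝ (Fin d),
      L w * (-(2 * a) * (inner ℝ w v * Real.exp (-a * ‖w‖ ^ 2)))
      = -(2 * a) * ∫ w, L w * inner ℝ w v * Real.exp (-a * ‖w‖ ^ 2) := by
    rw [← integral_const_mul]
    congr 1
    ext w
    ring
  rw [h3] at h
  rw [gaussianMass]
  rw [div_mul_eq_mul_div, eq_div_iff (by positivity)]
  linarith

lemma integral_bilinear_mul_gaussian {a : ℝ} (ha : 0 < a)
    (B : EuclideanSpace ℝ (Fin d) →L[ℝ] EuclideanSpace ℝ (Fin d) →L[ℝ] ℝ) :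
    Integrable (fun w : EuclideanSpace ℝ (Fin d) => B w w * Real.exp (-a * ‖w‖ ^ 2)) ∧
    ∫ w : EuclideanSpace ℝ (Fin d), B w w * Real.exp (-a * ‖w‖ ^ 2)
      = (∑ i, B (EuclideanSpace.single i 1) (EuclideanSpace.single i 1)) / (2 * a)
        * gaussianMass d a := by
  have hexp : ∀ w : EuclideanSpace ℝ (Fin d), B w w * Real.exp (-a * ‖w‖ ^ 2)
      = ∑ i, B.flip (EuclideanSpace.single i 1) w * inner ℝ w (EuclideanSpace.single i 1)
          * Real.exp (-a * ‖w‖ ^ 2) := by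
    intro w
    rw [← Finset.sum_mul]
    congr 1
    have hw : w = ∑ i, w i • EuclideanSpace.single i (1 : ℝ) := by
      simpa using ((EuclideanSpace.basisFun (Fin d) ℝ).sum_repr w).symm
    calc B w w = B w (∑ i, w i • EuclideanSpace.single i (1 : ℝ)) := by rw [← hw]
      _ = _ := by
        rw [map_sum]
        simp [EuclideanSpace.inner_single_right, mul_comm]
  have key := fun i : Fin d => integral_apply_mul_inner_mul_gaussian ha
    (B.flip (EuclideanSpace.single i 1)) (EuclideanSpace.single i 1)
  simp only [hexp]
  refine ⟨integrable_finsetSum _ fun i _ => (key i).1, ?_⟩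
  rw [integral_finsetSum _ fun i _ => (key i).1, Finset.sum_div, Finset.sum_mul]
  exact Finset.sum_congr rfl fun i _ => (key i).2

end Gaussian

/-! ### Laplace's method for localized functions -/

section Laplace

variable {d : ℕ}

lemma gaussianAverage_eq_integral_add (a : ℝ) (g : EuclideanSpace ℝ (Fin d) → ℝ)
    (y : EuclideanSpace ℝ (Fin d)) :
    gaussianAverage a g y = ∫ w, g (y + w) * Real.exp (-a * ‖w‖ ^ 2) := by
  rw [gaussianAverage, ← integral_add_left_eq_self _ y]
  simp

lemma gaussianAverage_eq_integral_sub (a : ℝ) (g : EuclideanSpace ℝ (Fin d) → ℝ)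
    (y : EuclideanSpace ℝ (Fin d)) :
    gaussianAverage a g y = ∫ w, g (y - w) * Real.exp (-a * ‖w‖ ^ 2) := by
  rw [gaussianAverage_eq_integral_add, ← integral_neg_eq_self]
  simp [sub_eq_add_neg]

/-- Laplace's method with the remainder made explicit: a bound on the symmetrized Taylor remainder
of `g` at `y` gives an expansion of its Gaussian average. Odd-order terms cancel by symmetry. -/
lemma abs_gaussianAverage_sub_le {g : EuclideanSpace ℝ (Fin d) → ℝ} {y : EuclideanSpace ℝ (Fin d)}
    {a c C M : ℝ} (ha : 0 < a) (hg : AEStronglyMeasurable g) (hM : ∀ z, |g z| ≤ M)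
    (B : EuclideanSpace ℝ (Fin d) →L[ℝ] EuclideanSpace ℝ (Fin d) →L[ℝ] ℝ) (k : ℕ)
    (h : ∀ w, |g (y + w) + g (y - w) - 2 * c - B w w| ≤ C * ‖w‖ ^ (2 * k)) (hC : 0 ≤ C) :
    |gaussianAverage a g y
        - (c + (∑ i, B (EuclideanSpace.single i 1) (EuclideanSpace.single i 1)) / (4 * a))
          * gaussianMass d a|
      ≤ C * (k.factorial * (2 / a) ^ k * 2 ^ ((d : ℝ) / 2)) * gaussianMass d a := by
  have i1 : Integrable (fun w => g (y + w) * Real.exp (-a * ‖w‖ ^ 2)) := by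
    refine (integrable_gaussian ha).bdd_mul (c := M) ?_ (.of_forall fun w => hM _)
    exact hg.comp_measurePreserving (measurePreserving_add_left volume y)
  have i2 : Integrable (fun w => g (y - w) * Real.exp (-a * ‖w‖ ^ 2)) := by
    refine (integrable_gaussian ha).bdd_mul (c := M) ?_ (.of_forall fun w => hM _)
    simp only [sub_eq_add_neg]
    exact hg.comp_measurePreserving
      ((measurePreserving_add_left volume y).comp (Measure.measurePreserving_neg volume))
  have i3 := (integrable_gaussian (d := d) ha).const_mul (2 * c)
  obtain ⟨i4, e4⟩ := integral_bilinear_mul_gaussian ha B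
  have e : ∫ w, (g (y + w) + g (y - w) - 2 * c - B w w) * Real.exp (-a * ‖w‖ ^ 2)
      = 2 * (gaussianAverage a g y
        - (c + (∑ i, B (EuclideanSpace.single i 1) (EuclideanSpace.single i 1)) / (4 * a))
          * gaussianMass d a) := by
    simp only [sub_mul, add_mul]
    rw [integral_sub (by exact (i1.add i2).sub i3) i4, integral_sub (by exact i1.add i2) i3,
      integral_add i1 i2, e4,
      ← gaussianAverage_eq_integral_add, ← gaussianAverage_eq_integral_sub, integral_const_mul,
      ← gaussianMass]
    ring
  have hb : |∫ w, (g (y + w) + g (y - w) - 2 * c - B w w) * Real.exp (-a * ‖w‖ ^ 2)|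
      ≤ C * (k.factorial * (2 / a) ^ k * 2 ^ ((d : ℝ) / 2)) * gaussianMass d a := by
    rw [mul_assoc]
    rw [← Real.norm_eq_abs]
    refine (norm_integral_le_of_norm_le
      ((integrable_norm_pow_mul_gaussian ha k).const_mul C) (.of_forall fun w => ?_)).trans ?_
    · rw [norm_mul, Real.norm_of_nonneg (Real.exp_pos _).le, ← mul_assoc]
      exact mul_le_mul_of_nonneg_right (h w) (Real.exp_pos _).le
    · rw [integral_const_mul]
      exact mul_le_mul_of_nonneg_left (integral_norm_pow_mul_gaussian_le ha k) hC
  rw [e, abs_mul, abs_two] at hb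
  linarith [abs_nonneg (gaussianAverage a g y
        - (c + (∑ i, B (EuclideanSpace.single i 1) (EuclideanSpace.single i 1)) / (4 * a))
          * gaussianMass d a)]

/-- Truncating a function to a ball preserves the Taylor bound on second differences, now for all
increments: outside the ball the powers of `‖w‖` dominate. -/
lemma exists_indicator_second_difference_le {f : EuclideanSpace ℝ (Fin d) → ℝ}
    {x : EuclideanSpace ℝ (Fin d)} {δ C M : ℝ} (hδ : 0 < δ) (hC : 0 ≤ C)
    {B : EuclideanSpace ℝ (Fin d) →
      EuclideanSpace ℝ (Fin d) →L[ℝ] EuclideanSpace ℝ (Fin d) →L[ℝ] ℝ} (j : ℕ)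
    (h : ∀ y ∈ Metric.ball x (δ / 2), ∀ w, ‖w‖ < δ / 2 →
      |f (y + w) + f (y - w) - 2 * f y - B y w w| ≤ C * ‖w‖ ^ (2 * (j + 1)))
    (hf : ∀ y ∈ Metric.ball x δ, |f y| ≤ M) (hB : ∀ y ∈ Metric.ball x (δ / 2), ‖B y‖ ≤ M) :
    ∃ C', 0 ≤ C' ∧ ∀ y ∈ Metric.ball x (δ / 2), ∀ w,
      |(Metric.ball x δ).indicator f (y + w) + (Metric.ball x δ).indicator f (y - w)
        - 2 * f y - B y w w| ≤ C' * ‖w‖ ^ (2 * (j + 1)) := by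
  have hM : 0 ≤ M := (abs_nonneg _).trans (hf x (Metric.mem_ball_self hδ))
  have hind : ∀ z, |(Metric.ball x δ).indicator f z| ≤ M := by
    intro z
    by_cases hz : z ∈ Metric.ball x δ
    · simpa [hz] using hf z hz
    · simpa [hz] using hM
  have hr : (0 : ℝ) < δ / 2 := by positivity
  refine ⟨C + (4 * M / (δ / 2) ^ (2 * (j + 1)) + M / (δ / 2) ^ (2 * j)), by positivity,
    fun y hy w => ?_⟩
  rcases lt_or_ge ‖w‖ (δ / 2) with hw | hw
  · obtain ⟨h1, h2⟩ := add_mem_ball_and_sub_mem_ball hy hw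
    rw [Set.indicator_of_mem h1, Set.indicator_of_mem h2]
    refine (h y hy w hw).trans ?_
    gcongr
    linarith [show (0 : ℝ) ≤ 4 * M / (δ / 2) ^ (2 * (j + 1)) + M / (δ / 2) ^ (2 * j) by positivity]
  · have b1 := hind (y + w)
    have b2 := hind (y - w)
    have b3 := hf y (Metric.ball_subset_ball (by linarith) hy)
    have b4 : |B y w w| ≤ M * ‖w‖ ^ 2 := by
      calc |B y w w| ≤ ‖B y‖ * ‖w‖ * ‖w‖ := (B y).le_opNorm₂ w w
        _ ≤ M * ‖w‖ * ‖w‖ := by gcongr; exact hB y hy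
        _ = _ := by ring
    have b5 : 4 * M ≤ 4 * M / (δ / 2) ^ (2 * (j + 1)) * ‖w‖ ^ (2 * (j + 1)) := by
      rw [div_mul_eq_mul_div, le_div_iff₀ (by positivity)]
      gcongr
    have b6 : M * ‖w‖ ^ 2 ≤ M / (δ / 2) ^ (2 * j) * ‖w‖ ^ (2 * (j + 1)) := by
      rw [mul_add, pow_add, ← mul_assoc, mul_one]
      gcongr
      rw [div_mul_eq_mul_div, le_div_iff₀ (by positivity)]
      gcongr
    have b7 : 0 ≤ C * ‖w‖ ^ (2 * (j + 1)) := by positivity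
    rw [add_mul, add_mul]
    rw [abs_le] at *
    constructor <;> linarith

lemma aestronglyMeasurable_indicator_ball {f : EuclideanSpace ℝ (Fin d) → ℝ}
    {x : EuclideanSpace ℝ (Fin d)} {δ : ℝ}
    (hf : ∀ y ∈ Metric.ball x δ, ContinuousAt f y) :
    AEStronglyMeasurable ((Metric.ball x δ).indicator f) :=
  (aestronglyMeasurable_indicator_iff Metric.isOpen_ball.measurableSet).2
    (ContinuousOn.aestronglyMeasurable (fun y hy => (hf y hy).continuousWithinAt)
      Metric.isOpen_ball.measurableSet)

lemma ContinuousAt.eventually_norm_le {F : Type*} [NormedAddCommGroup F]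
    {f : EuclideanSpace ℝ (Fin d) → F} {x : EuclideanSpace ℝ (Fin d)} (hf : ContinuousAt f x) :
    ∀ᶠ y in nhds x, ‖f y‖ ≤ ‖f x‖ + 1 :=
  (hf.norm.eventually_lt_const (lt_add_one _)).mono fun _ h => h.le

/-- Leading-order Laplace asymptotics at `x`, localized to a small ball. -/
lemma ContDiffAt.exists_gaussianAverage_sub_le {f : EuclideanSpace ℝ (Fin d) → ℝ}
    {x : EuclideanSpace ℝ (Fin d)} (hf : ContDiffAt ℝ 2 f x) :
    ∃ δ₀ > 0, ∀ δ, 0 < δ → δ ≤ δ₀ → ∃ C, 0 ≤ C ∧ ∀ a, 0 < a →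
      |gaussianAverage a ((Metric.ball x δ).indicator f) x - f x * gaussianMass d a|
        ≤ C / a * gaussianMass d a := by
  obtain ⟨δ₁, hδ₁, C, hC, h⟩ := hf.exists_second_difference_le
  obtain ⟨δ₂, hδ₂, h'⟩ := Metric.eventually_nhds_iff_ball.1
    ((hf.continuousAt.eventually_norm_le).and (hf.eventually (by simp)))
  refine ⟨min δ₁ δ₂, by positivity, fun δ hδ hle => ?_⟩
  have hle1 := hle.trans (min_le_left _ _)
  have hle2 := hle.trans (min_le_right _ _)
  have hsub : Metric.ball x δ ⊆ Metric.ball x δ₂ := Metric.ball_subset_ball hle2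
  obtain ⟨C', hC', hb⟩ := exists_indicator_second_difference_le (f := f) (x := x) (B := fun _ => 0)
    (M := ‖f x‖ + 1) hδ hC 0
    (fun y hy w hw => by
      simpa using h y (Metric.ball_subset_ball (by linarith) hy) w (by linarith))
    (fun y hy => (h' y (hsub hy)).1) (fun y _ => ContinuousLinearMap.opNorm_zero.trans_le (by positivity))
  refine ⟨C' * (2 * 2 ^ ((d : ℝ) / 2)), by positivity, fun a ha => ?_⟩
  have := abs_gaussianAverage_sub_le (M := ‖f x‖ + 1) ha
    (aestronglyMeasurable_indicator_ball fun y hy => (h' y (hsub hy)).2.continuousAt)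
    (fun z => by
      by_cases hz : z ∈ Metric.ball x δ
      · simpa [hz] using (h' z (hsub hz)).1
      · simp [hz]; positivity) 0 1 (hb x (Metric.mem_ball_self (by positivity))) hC'
  refine (le_of_eq ?_).trans (this.trans_eq ?_)
  · simp
  · simp only [Nat.factorial_one, Nat.cast_one, pow_one]
    ring

lemma laplacian_eq_sum_fderiv_fderiv (f : EuclideanSpace ℝ (Fin d) → ℝ) :
    Δ f = fun y => ∑ i, fderiv ℝ (fderiv ℝ f) y (EuclideanSpace.single i 1)
      (EuclideanSpace.single i 1) := by
  rw [InnerProductSpace.laplacian_eq_iteratedFDeriv_orthonormalBasis f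
    (EuclideanSpace.basisFun (Fin d) ℝ)]
  simp [iteratedFDeriv_two_apply]

/-- Second-order Laplace asymptotics near `x`, localized to a small ball and uniform in the base
point `y`. -/
lemma ContDiffAt.exists_gaussianAverage_sub_laplacian_le {f : EuclideanSpace ℝ (Fin d) → ℝ}
    {x : EuclideanSpace ℝ (Fin d)} (hf : ContDiffAt ℝ 4 f x) :
    ∃ δ₀ > 0, ∀ δ, 0 < δ → δ ≤ δ₀ → ∃ C, 0 ≤ C ∧ ∀ y ∈ Metric.ball x (δ / 2), ∀ a, 0 < a →
      |gaussianAverage a ((Metric.ball x δ).indicator f) y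
        - (f y + Δ f y / (4 * a)) * gaussianMass d a| ≤ C / a ^ 2 * gaussianMass d a := by
  have hf2 : ContDiffAt ℝ 2 (fderiv ℝ (fderiv ℝ f)) x :=
    (hf.fderiv_right (m := 3) (by norm_num)).fderiv_right (by norm_num)
  obtain ⟨δ₁, hδ₁, C, hC, h⟩ := hf.exists_second_difference_sub_le
  obtain ⟨δ₂, hδ₂, h'⟩ := Metric.eventually_nhds_iff_ball.1
    (((hf.continuousAt.eventually_norm_le).and (hf.eventually (by simp))).and
      hf2.continuousAt.eventually_norm_le)
  refine ⟨min δ₁ δ₂, by positivity, fun δ hδ hle => ?_⟩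
  have hle1 := hle.trans (min_le_left _ _)
  have hle2 := hle.trans (min_le_right _ _)
  have hsub : Metric.ball x δ ⊆ Metric.ball x δ₂ := Metric.ball_subset_ball hle2
  set M := max (‖f x‖ + 1) (‖fderiv ℝ (fderiv ℝ f) x‖ + 1)
  have hM : 0 ≤ M := le_max_of_le_left (by positivity)
  obtain ⟨C', hC', hb⟩ := exists_indicator_second_difference_le (f := f) (x := x)
    (B := fun y => fderiv ℝ (fderiv ℝ f) y) (M := M) hδ hC 1
    (fun y hy w hw => by
      simpa using h y (Metric.ball_subset_ball (by linarith) hy) w (by linarith))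
    (fun y hy => (h' y (hsub hy)).1.1.trans (le_max_left _ _))
    (fun y hy => (h' y (hsub (Metric.ball_subset_ball (by linarith) hy))).2.trans
      (le_max_right _ _))
  refine ⟨C' * (2 * 2 ^ 2 * 2 ^ ((d : ℝ) / 2)), by positivity, fun y hy a ha => ?_⟩
  have := abs_gaussianAverage_sub_le (M := M) ha
    (aestronglyMeasurable_indicator_ball fun y hy => (h' y (hsub hy)).1.2.continuousAt)
    (fun z => by
      by_cases hz : z ∈ Metric.ball x δ
      · simp only [hz, Set.indicator_of_mem]
        exact (h' z (hsub hz)).1.1.trans (le_max_left _ _)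
      · simpa [hz] using hM) _ 2 (hb y hy) hC'
  refine (le_of_eq ?_).trans (this.trans_eq ?_)
  · rw [laplacian_eq_sum_fderiv_fderiv]
  · simp only [Nat.factorial_two, Nat.cast_ofNat]
    ring

end Laplace

/-! ### The transition kernel and its decay -/

section Kernel

variable {d : ℕ} {φ : EuclideanSpace ℝ (Fin d) → ℝ} {x : EuclideanSpace ℝ (Fin d)}

lemma integrable_gaussian_sub {a : ℝ} (ha : 0 < a) (y : EuclideanSpace ℝ (Fin d)) :
    Integrable (fun z => Real.exp (-a * ‖z - y‖ ^ 2)) :=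
  (integrable_gaussian ha).comp_sub_right y

lemma integral_gaussian_sub (a : ℝ) (y : EuclideanSpace ℝ (Fin d)) :
    ∫ z, Real.exp (-a * ‖z - y‖ ^ 2) = gaussianMass d a :=
  integral_sub_right_eq_self (fun w => Real.exp (-a * ‖w‖ ^ 2)) y

lemma gaussian_le_one {a : ℝ} (ha : 0 < a) (z : EuclideanSpace ℝ (Fin d)) :
    Real.exp (-a * ‖z‖ ^ 2) ≤ 1 :=
  Real.exp_le_one_iff.2 (by nlinarith [sq_nonneg ‖z‖])

lemma mul_gaussian_le {a : ℝ} (ha : 0 < a) (t : ℝ) (z : EuclideanSpace ℝ (Fin d)) :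
    t * Real.exp (-a * ‖z‖ ^ 2) ≤ t ^ 2 + Real.exp (-a * ‖z‖ ^ 2) := by
  have h1 := gaussian_le_one ha z
  have h0 := Real.exp_pos (-a * ‖z‖ ^ 2)
  nlinarith [sq_nonneg (t - Real.exp (-a * ‖z‖ ^ 2)), sq_nonneg t]

/-- A square-integrable weight is integrable against every Gaussian. -/
lemma integrable_mul_gaussian (hc : Continuous φ) (hpos : ∀ z, 0 < φ z)
    (hint : Integrable fun z => φ z ^ 2) {a : ℝ} (ha : 0 < a) (y : EuclideanSpace ℝ (Fin d)) :
    Integrable (fun z => φ z * Real.exp (-a * ‖z - y‖ ^ 2)) := by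
  refine (hint.add (integrable_gaussian_sub ha y)).mono' (by fun_prop) (.of_forall fun z => ?_)
  rw [Real.norm_of_nonneg (mul_pos (hpos z) (Real.exp_pos _)).le]
  exact mul_gaussian_le ha _ _

/-- Lower bound for the Gaussian average by its part on a closed ball. -/
lemma mul_exp_mul_volume_le_gaussianAverage (hc : Continuous φ) (hpos : ∀ z, 0 < φ z)
    (hint : Integrable fun z => φ z ^ 2) {a m q r : ℝ} (ha : 0 < a)
    {p y : EuclideanSpace ℝ (Fin d)} (hφ : ∀ z ∈ Metric.closedBall p r, m ≤ φ z)
    (hq : ∀ z ∈ Metric.closedBall p r, ‖z - y‖ ^ 2 ≤ q) :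
    volume.real (Metric.closedBall (0 : EuclideanSpace ℝ (Fin d)) r) * (m * Real.exp (-a * q))
      ≤ gaussianAverage a φ y := by
  have hi := integrable_mul_gaussian hc hpos hint ha y
  calc volume.real (Metric.closedBall (0 : EuclideanSpace ℝ (Fin d)) r) * (m * Real.exp (-a * q))
      = ∫ z in Metric.closedBall p r, m * Real.exp (-a * q) := by
        rw [setIntegral_const, smul_eq_mul, Measure.real, Measure.real,
          Measure.addHaar_closedBall_center volume p r]
    _ ≤ ∫ z in Metric.closedBall p r, φ z * Real.exp (-a * ‖z - y‖ ^ 2) := by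
        refine setIntegral_mono_on ?_ hi.integrableOn measurableSet_closedBall fun z hz => ?_
        · exact integrableOn_const measure_closedBall_lt_top.ne
        · refine mul_le_mul (hφ z hz) (Real.exp_le_exp.2 ?_) (Real.exp_pos _).le (hpos z).le
          nlinarith [hq z hz]
    _ ≤ gaussianAverage a φ y :=
        setIntegral_le_integral hi
          (.of_forall fun z => (mul_pos (hpos z) (Real.exp_pos _)).le)

/-- Lower bounds for the normalizing factor, uniform in `y` and `a`. For `y` far from `x` the
ball of integration is centred at a point closer to `y` than `x` is, which gains a factor
exponentially large in `a` over the Gaussian centred at `x`. -/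
lemma exists_gaussianAverage_lower_bound (hc : Continuous φ) (hpos : ∀ z, 0 < φ z)
    (hint : Integrable fun z => φ z ^ 2) (x : EuclideanSpace ℝ (Fin d)) {δ : ℝ} (hδ : 0 < δ) :
    ∃ c > 0, ∀ a, 0 < a →
      (∀ y ∈ Metric.ball x δ, c * Real.exp (-a * (4 * δ ^ 2)) ≤ gaussianAverage a φ y) ∧
      ∀ y ∉ Metric.ball x δ, c * Real.exp (a * (δ ^ 2 / 4)) * Real.exp (-a * ‖x - y‖ ^ 2)
        ≤ gaussianAverage a φ y := by
  obtain ⟨z₀, -, hz₀⟩ := (isCompact_closedBall x δ).exists_isMinOn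
    ⟨x, Metric.mem_closedBall_self hδ.le⟩ hc.continuousOn
  have hm : ∀ z ∈ Metric.closedBall x δ, φ z₀ ≤ φ z := fun z hz => hz₀ hz
  have hv : 0 < volume.real (Metric.closedBall (0 : EuclideanSpace ℝ (Fin d)) (δ / 4)) :=
    ENNReal.toReal_pos (Metric.measure_closedBall_pos volume _ (by positivity)).ne'
      measure_closedBall_lt_top.ne
  refine ⟨_, mul_pos hv (hpos z₀), fun a ha => ⟨fun y hy => ?_, fun y hy => ?_⟩⟩
  · rw [mul_assoc]
    refine mul_exp_mul_volume_le_gaussianAverage hc hpos hint ha (p := x)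
      (fun z hz => hm z (Metric.closedBall_subset_closedBall (by linarith) hz)) fun z hz => ?_
    have h1 : ‖z - x‖ ≤ δ / 4 := by simpa [dist_eq_norm] using hz
    have h2 : ‖y - x‖ < δ := by simpa [dist_eq_norm] using hy
    have h3 : ‖z - y‖ ≤ 2 * δ := by
      calc ‖z - y‖ = ‖(z - x) - (y - x)‖ := by congr 1; abel
        _ ≤ ‖z - x‖ + ‖y - x‖ := norm_sub_le _ _
        _ ≤ 2 * δ := by linarith
    calc ‖z - y‖ ^ 2 ≤ (2 * δ) ^ 2 := by gcongr
      _ = 4 * δ ^ 2 := by ring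
  · have ht : δ ≤ ‖y - x‖ := by simpa [dist_eq_norm] using hy
    set t := ‖y - x‖
    have ht0 : 0 < t := hδ.trans_le ht
    -- the centre is moved from `x` by `δ / 2` in the direction of `y`
    set u : EuclideanSpace ℝ (Fin d) := (δ / (2 * t)) • (y - x)
    have hu : ‖u‖ = δ / 2 := by
      rw [norm_smul, Real.norm_of_nonneg (by positivity)]
      change δ / (2 * t) * t = _
      field_simp
    have huy : ‖x + u - y‖ = t - δ / 2 := by
      have : x + u - y = (-(1 - δ / (2 * t))) • (y - x) := by
        rw [neg_smul, sub_smul, one_smul]; change x + u - y = -(y - x - u); abel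
      rw [this, norm_smul, norm_neg, Real.norm_of_nonneg]
      · change (1 - δ / (2 * t)) * t = _
        field_simp
      · rw [sub_nonneg, div_le_one (by positivity)]; linarith
    have key := mul_exp_mul_volume_le_gaussianAverage hc hpos hint ha (p := x + u)
      (r := δ / 4) (y := y) (q := t ^ 2 - δ ^ 2 / 4) (fun z hz => hm z ?_) fun z hz => ?_
    · refine le_trans (le_of_eq ?_) key
      rw [mul_assoc, mul_assoc, ← Real.exp_add, norm_sub_rev x y]
      change _ * (_ * Real.exp (_ + -a * t ^ 2)) = _
      ring_nf
    · have h1 : ‖z - (x + u)‖ ≤ δ / 4 := by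
        rw [← dist_eq_norm]; exact hz
      rw [Metric.mem_closedBall, dist_eq_norm]
      calc ‖z - x‖ = ‖(z - (x + u)) + u‖ := by congr 1; abel
        _ ≤ ‖z - (x + u)‖ + ‖u‖ := norm_add_le _ _
        _ ≤ δ := by linarith
    · have h1 : ‖z - (x + u)‖ ≤ δ / 4 := by
        rw [← dist_eq_norm]; exact hz
      have h2 : ‖z - y‖ ≤ t - δ / 4 := by
        calc ‖z - y‖ = ‖(z - (x + u)) + (x + u - y)‖ := by congr 1; abel
          _ ≤ ‖z - (x + u)‖ + ‖x + u - y‖ := norm_add_le _ _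
          _ ≤ t - δ / 4 := by linarith
      calc ‖z - y‖ ^ 2 ≤ (t - δ / 4) ^ 2 := by gcongr
        _ ≤ t ^ 2 - δ ^ 2 / 4 := by nlinarith

/-- The factor by which `ρ₀ y` is multiplied in the kernel formula, for the weight
`φ = exp (-(β / 2) V)` and the Gaussian rate `a = β / (4 T)`. -/
noncomputable def transitionKernel (a : ℝ) (φ : EuclideanSpace ℝ (Fin d) → ℝ)
    (x y : EuclideanSpace ℝ (Fin d)) : ℝ :=
  φ x * Real.exp (-a * ‖x - y‖ ^ 2) / gaussianAverage a φ y

lemma gaussianAverage_pos (hc : Continuous φ) (hpos : ∀ z, 0 < φ z)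
    (hint : Integrable fun z => φ z ^ 2) {a : ℝ} (ha : 0 < a) (y : EuclideanSpace ℝ (Fin d)) :
    0 < gaussianAverage a φ y := by
  obtain ⟨c, hc0, h⟩ := exists_gaussianAverage_lower_bound hc hpos hint y one_pos
  exact (by positivity : (0 : ℝ) < c * Real.exp (-a * (4 * 1 ^ 2))).trans_le
    ((h a ha).1 y (Metric.mem_ball_self one_pos))

lemma transitionKernel_nonneg (hc : Continuous φ) (hpos : ∀ z, 0 < φ z)
    (hint : Integrable fun z => φ z ^ 2) {a : ℝ} (ha : 0 < a) (y : EuclideanSpace ℝ (Fin d)) :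
    0 ≤ transitionKernel a φ x y :=
  div_nonneg (mul_nonneg (hpos x).le (Real.exp_pos _).le)
    (gaussianAverage_pos hc hpos hint ha y).le

/-- The kernel is bounded locally uniformly in `a`, and exponentially small in `a` away from the
diagonal, uniformly in `y`. -/
lemma exists_transitionKernel_le (hc : Continuous φ) (hpos : ∀ z, 0 < φ z)
    (hint : Integrable fun z => φ z ^ 2) (x : EuclideanSpace ℝ (Fin d)) {δ : ℝ} (hδ : 0 < δ) :
    ∃ C, 0 ≤ C ∧ ∀ a, 0 < a →
      (∀ y, transitionKernel a φ x y ≤ C * Real.exp (a * (4 * δ ^ 2))) ∧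
      ∀ y ∉ Metric.ball x δ, transitionKernel a φ x y ≤ C * Real.exp (-a * (δ ^ 2 / 4)) := by
  obtain ⟨c, hc0, h⟩ := exists_gaussianAverage_lower_bound hc hpos hint x hδ
  have hx := hpos x
  have far : ∀ a, 0 < a → ∀ y ∉ Metric.ball x δ,
      transitionKernel a φ x y ≤ φ x / c * Real.exp (-a * (δ ^ 2 / 4)) := by
    intro a ha y hy
    rw [transitionKernel, div_le_iff₀ (gaussianAverage_pos hc hpos hint ha y)]
    calc φ x * Real.exp (-a * ‖x - y‖ ^ 2)
        = φ x / c * Real.exp (-a * (δ ^ 2 / 4))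
          * (c * Real.exp (a * (δ ^ 2 / 4)) * Real.exp (-a * ‖x - y‖ ^ 2)) := by
          rw [neg_mul a (δ ^ 2 / 4), Real.exp_neg]
          field_simp
      _ ≤ _ := by gcongr; exact (h a ha).2 y hy
  refine ⟨φ x / c, by positivity, fun a ha => ⟨fun y => ?_, far a ha⟩⟩
  by_cases hy : y ∈ Metric.ball x δ
  · rw [transitionKernel, div_le_iff₀ (gaussianAverage_pos hc hpos hint ha y)]
    calc φ x * Real.exp (-a * ‖x - y‖ ^ 2) ≤ φ x * 1 := by
          gcongr
          exact gaussian_le_one ha _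
      _ = φ x / c * Real.exp (a * (4 * δ ^ 2)) * (c * Real.exp (-a * (4 * δ ^ 2))) := by
          rw [neg_mul, Real.exp_neg]
          field_simp
      _ ≤ _ := by gcongr; exact (h a ha).1 y hy
  · refine (far a ha y hy).trans ?_
    gcongr
    · linarith
    · linarith [sq_nonneg δ]

lemma stronglyMeasurable_gaussianAverage (hc : Continuous φ) (a : ℝ) :
    StronglyMeasurable (gaussianAverage a φ) := by
  have : StronglyMeasurable (Function.uncurry fun (y z : EuclideanSpace ℝ (Fin d)) =>
      φ z * Real.exp (-a * ‖z - y‖ ^ 2)) := by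
    apply Continuous.stronglyMeasurable
    unfold Function.uncurry
    fun_prop
  exact this.integral_prod_right

lemma stronglyMeasurable_transitionKernel (hc : Continuous φ) (a : ℝ)
    (x : EuclideanSpace ℝ (Fin d)) : StronglyMeasurable (transitionKernel a φ x) := by
  refine StronglyMeasurable.div (Continuous.stronglyMeasurable (by fun_prop))
    (stronglyMeasurable_gaussianAverage hc a)

lemma integrable_transitionKernel_mul (hc : Continuous φ) (hpos : ∀ z, 0 < φ z)
    (hint : Integrable fun z => φ z ^ 2) {ρ : EuclideanSpace ℝ (Fin d) → ℝ} (hρ : Integrable ρ)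
    {a : ℝ} (ha : 0 < a) (x : EuclideanSpace ℝ (Fin d)) :
    Integrable fun y => transitionKernel a φ x y * ρ y := by
  obtain ⟨C, hC, h⟩ := exists_transitionKernel_le hc hpos hint x one_pos
  refine hρ.bdd_mul (c := C * Real.exp (a * (4 * 1 ^ 2)))
    (stronglyMeasurable_transitionKernel hc a x).aestronglyMeasurable (.of_forall fun y => ?_)
  rw [Real.norm_of_nonneg (transitionKernel_nonneg hc hpos hint ha y)]
  exact (h a ha).1 y

end Kernel

/-! ### Expansion of the normalizing factor -/

section Denominator

variable {d : ℕ} {φ : EuclideanSpace ℝ (Fin d) → ℝ} {x : EuclideanSpace ℝ (Fin d)}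

/-- An exponentially small quantity is negligible against `a⁻²`, also relative to the Gaussian
mass, which decays only polynomially. -/
lemma eventually_exp_neg_mul_le (d : ℕ) {c : ℝ} (hc : 0 < c) :
    ∀ᶠ a : ℝ in Filter.atTop, Real.exp (-c * a) ≤ 1 / a ^ 2 ∧
      Real.exp (-c * a) ≤ 1 / a ^ 2 * gaussianMass d a := by
  filter_upwards [(isLittleO_exp_neg_mul_rpow_atTop hc (-2 - (d : ℝ) / 2)).bound one_pos,
    Filter.eventually_ge_atTop 1] with a ha h1
  have h0 : 0 < a := one_pos.trans_le h1
  rw [Real.norm_of_nonneg (Real.exp_pos _).le, Real.norm_of_nonneg (by positivity), one_mul,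
    sub_eq_add_neg, Real.rpow_add h0] at ha
  have h2 : a ^ (-2 : ℝ) = 1 / a ^ 2 := by
    rw [Real.rpow_neg h0.le, one_div]; norm_cast
  rw [h2] at ha
  refine ⟨ha.trans (mul_le_of_le_one_right (by positivity) ?_), ha.trans ?_⟩
  · exact Real.rpow_le_one_of_one_le_of_nonpos h1 (by simp; positivity)
  · gcongr
    rw [gaussianMass, GaussianFourier.integral_rexp_neg_mul_sq_norm h0, finrank_euclideanSpace_fin,
      Real.rpow_neg h0.le, ← Real.inv_rpow h0.le, inv_eq_one_div]
    gcongr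
    linarith [Real.pi_gt_three]

/-- The mass outside a ball contributes negligibly to the Gaussian average. -/
lemma exists_gaussianAverage_sub_indicator_le (hc : Continuous φ) (hpos : ∀ z, 0 < φ z)
    (hint : Integrable fun z => φ z ^ 2) (x : EuclideanSpace ℝ (Fin d)) {δ : ℝ} (hδ : 0 < δ) :
    ∃ C, 0 ≤ C ∧ ∀ᶠ a : ℝ in Filter.atTop, ∀ y ∈ Metric.ball x (δ / 2),
      |gaussianAverage a φ y - gaussianAverage a ((Metric.ball x δ).indicator φ) y|
        ≤ C / a ^ 2 * gaussianMass d a := by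
  set Q := ∫ z, φ z ^ 2
  have hQ : 0 ≤ Q := integral_nonneg fun z => sq_nonneg _
  refine ⟨Q + 2 ^ ((d : ℝ) / 2), by positivity, ?_⟩
  filter_upwards [eventually_exp_neg_mul_le d (c := δ ^ 2 / 8) (by positivity),
    Filter.eventually_gt_atTop 0] with a ⟨h1, h2⟩ ha y hy
  have hy' : ‖y - x‖ < δ / 2 := by rw [← dist_eq_norm]; exact hy
  have hi := integrable_mul_gaussian hc hpos hint ha y
  have hi' : Integrable fun z => (Metric.ball x δ).indicator φ z * Real.exp (-a * ‖z - y‖ ^ 2) := by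
    refine (hi.indicator (measurableSet_ball (x := x) (ε := δ))).congr (.of_forall fun z => ?_)
    exact Set.indicator_mul_left (Metric.ball x δ) φ fun z => Real.exp (-a * ‖z - y‖ ^ 2)
  rw [gaussianAverage, gaussianAverage, ← integral_sub hi hi', ← Real.norm_eq_abs]
  have hbound : Integrable fun z => Real.exp (-(δ ^ 2 / 8) * a)
      * (φ z ^ 2 + Real.exp (-(a / 2) * ‖z - y‖ ^ 2)) :=
    (hint.add (integrable_gaussian_sub (half_pos ha) y)).const_mul _
  have hN := gaussianMass_pos (d := d) ha
  refine (norm_integral_le_of_norm_le hbound (.of_forall fun z => ?_)).trans ?_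
  · by_cases hz : z ∈ Metric.ball x δ
    · simp only [hz, Set.indicator_of_mem, sub_self, norm_zero]
      positivity
    · simp only [hz, Set.indicator_of_notMem, not_false_eq_true, zero_mul, sub_zero]
      have hz' : δ ≤ ‖z - x‖ := by simpa [dist_eq_norm] using hz
      have hzy : δ / 2 ≤ ‖z - y‖ := by
        have : ‖z - x‖ ≤ ‖z - y‖ + ‖y - x‖ := by
          calc ‖z - x‖ = ‖(z - y) + (y - x)‖ := by congr 1; abel
            _ ≤ _ := norm_add_le _ _
        linarith
      rw [Real.norm_of_nonneg (mul_pos (hpos z) (Real.exp_pos _)).le]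
      calc φ z * Real.exp (-a * ‖z - y‖ ^ 2)
          ≤ φ z * (Real.exp (-(δ ^ 2 / 8) * a) * Real.exp (-(a / 2) * ‖z - y‖ ^ 2)) := by
            have := (hpos z).le
            rw [← Real.exp_add]
            gcongr
            have : (δ / 2) ^ 2 ≤ ‖z - y‖ ^ 2 := by gcongr
            nlinarith
        _ = Real.exp (-(δ ^ 2 / 8) * a) * (φ z * Real.exp (-(a / 2) * ‖z - y‖ ^ 2)) := by ring
        _ ≤ _ := by
            gcongr
            exact mul_gaussian_le (half_pos ha) _ _
  · rw [integral_const_mul, integral_add hint (integrable_gaussian_sub (half_pos ha) y),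
      integral_gaussian_sub, gaussianMass_half ha]
    calc Real.exp (-(δ ^ 2 / 8) * a) * (Q + 2 ^ ((d : ℝ) / 2) * gaussianMass d a)
        = Real.exp (-(δ ^ 2 / 8) * a) * Q
          + Real.exp (-(δ ^ 2 / 8) * a) * (2 ^ ((d : ℝ) / 2) * gaussianMass d a) := by ring
      _ ≤ (1 / a ^ 2 * gaussianMass d a) * Q
          + (1 / a ^ 2) * (2 ^ ((d : ℝ) / 2) * gaussianMass d a) := by gcongr
      _ = _ := by ring

/-- Second-order expansion of the normalizing factor, uniform near `x`. -/
lemma exists_gaussianAverage_expansion (hc : Continuous φ) (hpos : ∀ z, 0 < φ z)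
    (hint : Integrable fun z => φ z ^ 2) (hφ : ContDiffAt ℝ 4 φ x) :
    ∃ δ₀ > 0, ∀ δ, 0 < δ → δ ≤ δ₀ → ∃ C, 0 ≤ C ∧ ∀ᶠ a : ℝ in Filter.atTop,
      ∀ y ∈ Metric.ball x δ,
      |gaussianAverage a φ y - (φ y + Δ φ y / (4 * a)) * gaussianMass d a|
        ≤ C / a ^ 2 * gaussianMass d a := by
  obtain ⟨δ₀, hδ₀, h⟩ := hφ.exists_gaussianAverage_sub_laplacian_le
  refine ⟨δ₀ / 2, by positivity, fun δ hδ hle => ?_⟩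
  obtain ⟨C₁, hC₁, h₁⟩ := h (2 * δ) (by positivity) (by linarith)
  obtain ⟨C₂, hC₂, h₂⟩ := exists_gaussianAverage_sub_indicator_le hc hpos hint x
    (δ := 2 * δ) (by positivity)
  rw [mul_div_cancel_left₀ δ two_ne_zero] at h₁ h₂
  refine ⟨C₂ + C₁, by positivity, ?_⟩
  filter_upwards [h₂, Filter.eventually_gt_atTop 0] with a h₂ ha y hy
  refine (abs_sub_le _ _ _).trans ((add_le_add (h₂ y hy) (h₁ y hy a ha)).trans_eq ?_)
  ring

/-- Reciprocal of `r = p + s q + O(s ^ 2)` to the same order, with an explicit constant depending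
only on bounds for `p` and `q`; this makes it uniform over base points. -/
lemma abs_inv_sub_le {p q r s m P M C : ℝ} (hm : 0 < m) (hp : m ≤ p) (hpP : p ≤ P) (hq : |q| ≤ M)
    (hs : 0 ≤ s) (hs1 : s ≤ 1) (hC : 0 ≤ C) (hr : |r - (p + s * q)| ≤ C * s ^ 2)
    (hrm : m / 2 ≤ r) :
    |r⁻¹ - (p⁻¹ - s * (q / p ^ 2))| ≤ (C * (M + P) + M ^ 2) / (m ^ 3 / 2) * s ^ 2 := by
  have hp0 : 0 < p := hm.trans_le hp
  have hr0 : 0 < r := (half_pos hm).trans_le hrm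
  have hM : 0 ≤ M := (abs_nonneg _).trans hq
  have e : r⁻¹ - (p⁻¹ - s * (q / p ^ 2))
      = ((r - (p + s * q)) * (s * q - p) + s ^ 2 * q ^ 2) / (p ^ 2 * r) := by
    field_simp
    ring
  have hden : m ^ 3 / 2 ≤ p ^ 2 * r := by
    calc m ^ 3 / 2 = m ^ 2 * (m / 2) := by ring
      _ ≤ p ^ 2 * r := by gcongr
  have hsq : |s * q - p| ≤ M + P := by
    refine (abs_sub _ _).trans (add_le_add ?_ ?_)
    · rw [abs_mul, abs_of_nonneg hs]
      calc s * |q| ≤ 1 * M := by gcongr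
        _ = M := one_mul M
    · rwa [abs_of_pos hp0]
  have hnum : |(r - (p + s * q)) * (s * q - p) + s ^ 2 * q ^ 2|
      ≤ (C * (M + P) + M ^ 2) * s ^ 2 := by
    refine (abs_add_le _ _).trans ?_
    rw [abs_mul, abs_mul, abs_of_nonneg (sq_nonneg s), abs_pow]
    calc |r - (p + s * q)| * |s * q - p| + s ^ 2 * |q| ^ 2
        ≤ (C * s ^ 2) * (M + P) + s ^ 2 * M ^ 2 := by gcongr
      _ = _ := by ring
  rw [e, abs_div, abs_of_pos (show 0 < p ^ 2 * r by positivity), div_mul_eq_mul_div]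
  have : 0 ≤ (C * (M + P) + M ^ 2) * s ^ 2 := (abs_nonneg _).trans hnum
  gcongr

end Denominator

/-! ### Expansion of the kernel average -/

section Expansion

variable {d : ℕ} {φ ρ : EuclideanSpace ℝ (Fin d) → ℝ} {x : EuclideanSpace ℝ (Fin d)}

lemma ContDiffAt.laplacian_two {f : EuclideanSpace ℝ (Fin d) → ℝ} (hf : ContDiffAt ℝ 4 f x) :
    ContDiffAt ℝ 2 (Δ f) x := by
  have hf2 : ContDiffAt ℝ 2 (fderiv ℝ (fderiv ℝ f)) x :=
    (hf.fderiv_right (m := 3) (by norm_num)).fderiv_right (by norm_num)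
  rw [laplacian_eq_sum_fderiv_fderiv]
  exact ContDiffAt.sum fun i _ => (hf2.clm_apply contDiffAt_const).clm_apply contDiffAt_const

/-- The first-order coefficient, in powers of `1 / (4 a)`, of the kernel average of `ρ` at `x`.
It combines the diffusion of `ρ / φ` with the correction due to the normalizing factor. -/
noncomputable def kernelGenerator (φ ρ : EuclideanSpace ℝ (Fin d) → ℝ)
    (x : EuclideanSpace ℝ (Fin d)) : ℝ :=
  φ x * (Δ (fun y => ρ y / φ y) x - ρ x * (Δ φ x / φ x ^ 2))

lemma integrable_indicator_mul_gaussian {g : EuclideanSpace ℝ (Fin d) → ℝ} {δ M a : ℝ}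
    (ha : 0 < a) (hg : ∀ y ∈ Metric.ball x δ, ContinuousAt g y)
    (hM : ∀ y ∈ Metric.ball x δ, ‖g y‖ ≤ M) :
    Integrable fun y => (Metric.ball x δ).indicator g y * Real.exp (-a * ‖y - x‖ ^ 2) := by
  refine (integrable_gaussian_sub ha x).bdd_mul (c := max M 0)
    (aestronglyMeasurable_indicator_ball hg) (.of_forall fun y => ?_)
  by_cases hy : y ∈ Metric.ball x δ
  · simp only [hy, Set.indicator_of_mem]
    exact (hM y hy).trans (le_max_left _ _)
  · simp [hy]

/-- Expansion of the contribution of a small ball around `x` to the kernel average. -/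
lemma exists_setIntegral_transitionKernel_expansion (hc : Continuous φ) (hpos : ∀ z, 0 < φ z)
    (hint : Integrable fun z => φ z ^ 2) (hφ : ContDiffAt ℝ 4 φ x) (hρ : Integrable ρ)
    (hρx : ContDiffAt ℝ 4 ρ x) :
    ∃ δ > 0, ∃ C, 0 ≤ C ∧ ∀ᶠ a : ℝ in Filter.atTop,
      |(∫ y in Metric.ball x δ, transitionKernel a φ x y * ρ y)
        - (ρ x + kernelGenerator φ ρ x / (4 * a))| ≤ C / a ^ 2 := by
  have hx := hpos x
  have hΔ := hφ.laplacian_two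
  have hφ2 : ContDiffAt ℝ 2 φ x := hφ.of_le (by norm_num)
  set g : EuclideanSpace ℝ (Fin d) → ℝ := fun y => ρ y / φ y with hgdef
  set h : EuclideanSpace ℝ (Fin d) → ℝ := fun y => ρ y * (Δ φ y / φ y ^ 2) with hhdef
  have hg : ContDiffAt ℝ 4 g x := hρx.div hφ hx.ne'
  have hh : ContDiffAt ℝ 2 h x :=
    (hρx.of_le (by norm_num)).mul (hΔ.div (hφ2.pow 2) (by positivity))
  obtain ⟨δ₁, hδ₁, H₁⟩ := exists_gaussianAverage_expansion hc hpos hint hφ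
  obtain ⟨δ₂, hδ₂, H₂⟩ := hg.exists_gaussianAverage_sub_laplacian_le
  obtain ⟨δ₃, hδ₃, H₃⟩ := hh.exists_gaussianAverage_sub_le
  obtain ⟨δ₄, hδ₄, H₄⟩ := Metric.eventually_nhds_iff_ball.1
    ((((hg.eventually (by simp)).and (hh.eventually (by simp))).and
      (hg.continuousAt.eventually_norm_le.and hh.continuousAt.eventually_norm_le)).and
      ((hΔ.continuousAt.eventually_norm_le.and hρx.continuousAt.eventually_norm_le).and
      (hφ.continuousAt.eventually_norm_le.and
        (hφ.continuousAt.eventually_const_lt (half_lt_self hx)))))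
  set δ := min (min δ₁ δ₂) (min δ₃ δ₄) with hδdef
  have hδ : 0 < δ := by positivity
  have hle₁ : δ ≤ δ₁ := (min_le_left _ _).trans (min_le_left _ _)
  have hle₂ : δ ≤ δ₂ := (min_le_left _ _).trans (min_le_right _ _)
  have hle₃ : δ ≤ δ₃ := (min_le_right _ _).trans (min_le_left _ _)
  have hle₄ : δ ≤ δ₄ := (min_le_right _ _).trans (min_le_right _ _)
  have hsub : Metric.ball x δ ⊆ Metric.ball x δ₄ := Metric.ball_subset_ball hle₄
  obtain ⟨C₁, hC₁, E₁⟩ := H₁ δ hδ hle₁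
  obtain ⟨C₂, hC₂, E₂⟩ := H₂ δ hδ hle₂
  obtain ⟨C₃, hC₃, E₃⟩ := H₃ δ hδ hle₃
  set m := φ x / 2
  have hm : 0 < m := half_pos hx
  set P := ‖φ x‖ + 1
  set M := ‖Δ φ x‖ + 1
  set R := ‖ρ x‖ + 1
  have hM : 0 ≤ M := by positivity
  have hP : 0 ≤ P := by positivity
  have hR : 0 ≤ R := by positivity
  set K := (16 * C₁ * (M + P) + M ^ 2) / (m ^ 3 / 2)
  have hK : 0 ≤ K := by positivity
  refine ⟨δ, hδ, φ x * (R * K / 16 + C₂ + C₃ / 4), by positivity, ?_⟩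
  filter_upwards [E₁, Filter.eventually_ge_atTop 1,
    Filter.eventually_ge_atTop ((M + 16 * C₁) / (2 * m))] with a E₁ ha1 ham
  have ha : 0 < a := one_pos.trans_le ha1
  set N := gaussianMass d a with hNdef
  have hN : 0 < N := gaussianMass_pos ha
  set s := 1 / (4 * a) with hsdef
  have hs : 0 ≤ s := by positivity
  have hs1 : s ≤ 1 := by rw [hsdef, div_le_one (by positivity)]; linarith
  have hs2 : s ^ 2 = 1 / a ^ 2 / 16 := by rw [hsdef]; field_simp; norm_num
  have hsm : s * (M + 16 * C₁) ≤ m / 2 := by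
    rw [div_le_iff₀ (by positivity)] at ham
    rw [hsdef, one_div_mul_eq_div, div_le_iff₀ (by positivity)]
    linarith
  -- the kernel on the ball, with the normalizing factor replaced by its expansion
  have hpt : ∀ y ∈ Metric.ball x δ, |transitionKernel a φ x y * ρ y
      - φ x / N * (g y - s * h y) * Real.exp (-a * ‖y - x‖ ^ 2)|
      ≤ φ x / N * (R * (K * s ^ 2)) * Real.exp (-a * ‖y - x‖ ^ 2) := by
    intro y hy
    obtain ⟨-, ⟨b1, b2⟩, b3, b4⟩ := H₄ y (hsub hy)
    rw [Real.norm_eq_abs] at b1 b2 b3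
    have hD := gaussianAverage_pos hc hpos hint ha y
    have hy0 := hpos y
    have hr : |gaussianAverage a φ y / N - (φ y + s * Δ φ y)| ≤ 16 * C₁ * s ^ 2 := by
      have e : gaussianAverage a φ y / N - (φ y + s * Δ φ y)
          = (gaussianAverage a φ y - (φ y + Δ φ y / (4 * a)) * N) / N := by
        rw [hsdef]; field_simp
      rw [e, abs_div, abs_of_pos hN, div_le_iff₀ hN]
      refine (E₁ y hy).trans_eq ?_
      rw [hs2]; ring
    have hrm : m / 2 ≤ gaussianAverage a φ y / N := by
      have t1 : |s * Δ φ y| ≤ s * M := by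
        rw [abs_mul, abs_of_nonneg hs]; gcongr
      have t2 : 16 * C₁ * s ^ 2 ≤ s * (16 * C₁) := by
        have : s ^ 2 ≤ s := by nlinarith
        rw [mul_comm]
        gcongr
      have t3 := (abs_le.1 hr).1
      have t4 := (abs_le.1 t1).1
      linarith
    have hinv := abs_inv_sub_le hm b4.le ((le_abs_self _).trans b3) b1 hs hs1
      (by positivity : 0 ≤ 16 * C₁) hr hrm
    have e : transitionKernel a φ x y * ρ y
        - φ x / N * (g y - s * h y) * Real.exp (-a * ‖y - x‖ ^ 2)
        = φ x / N * (ρ y * ((gaussianAverage a φ y / N)⁻¹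
          - ((φ y)⁻¹ - s * (Δ φ y / φ y ^ 2)))) * Real.exp (-a * ‖y - x‖ ^ 2) := by
      rw [transitionKernel, hgdef, hhdef, norm_sub_rev x y]
      field_simp
    rw [e, abs_mul, abs_mul, abs_mul, abs_of_pos (Real.exp_pos _), abs_of_pos (div_pos hx hN)]
    gcongr
  have ig := integrable_indicator_mul_gaussian (x := x) (δ := δ) ha
    (fun y hy => (H₄ y (hsub hy)).1.1.1.continuousAt) (fun y hy => (H₄ y (hsub hy)).1.2.1)
  have ih := integrable_indicator_mul_gaussian (x := x) (δ := δ) ha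
    (fun y hy => (H₄ y (hsub hy)).1.1.2.continuousAt) (fun y hy => (H₄ y (hsub hy)).1.2.2)
  have ik : Integrable ((Metric.ball x δ).indicator fun y => transitionKernel a φ x y * ρ y) :=
    (integrable_transitionKernel_mul hc hpos hint hρ ha x).indicator measurableSet_ball
  have hmain : |(∫ y in Metric.ball x δ, transitionKernel a φ x y * ρ y)
      - φ x / N * (gaussianAverage a ((Metric.ball x δ).indicator g) x
        - s * gaussianAverage a ((Metric.ball x δ).indicator h) x)|
      ≤ φ x * (R * (K * s ^ 2)) := by
    have e : (∫ y in Metric.ball x δ, transitionKernel a φ x y * ρ y)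
      - φ x / N * (gaussianAverage a ((Metric.ball x δ).indicator g) x
        - s * gaussianAverage a ((Metric.ball x δ).indicator h) x)
      = ∫ y, ((Metric.ball x δ).indicator (fun y => transitionKernel a φ x y * ρ y) y
        - φ x / N * ((Metric.ball x δ).indicator g y * Real.exp (-a * ‖y - x‖ ^ 2)
          - s * ((Metric.ball x δ).indicator h y * Real.exp (-a * ‖y - x‖ ^ 2)))) := by
      rw [integral_sub ik (by exact (ig.sub (ih.const_mul s)).const_mul _),
        integral_indicator measurableSet_ball, integral_const_mul,
        integral_sub ig (ih.const_mul s), integral_const_mul]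
      rfl
    rw [e, ← Real.norm_eq_abs]
    refine (norm_integral_le_of_norm_le ((integrable_gaussian_sub ha x).const_mul
      (φ x / N * (R * (K * s ^ 2)))) (.of_forall fun y => ?_)).trans_eq ?_
    · by_cases hy : y ∈ Metric.ball x δ
      · simp only [hy, Set.indicator_of_mem]
        rw [Real.norm_eq_abs]
        refine le_trans (le_of_eq ?_) (hpt y hy)
        congr 1
        ring
      · simp only [hy, Set.indicator_of_notMem, not_false_eq_true, zero_mul, mul_zero, sub_zero,
          norm_zero]
        positivity
    · rw [integral_const_mul, integral_gaussian_sub, ← hNdef]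
      field_simp
  have hE₂ := E₂ x (Metric.mem_ball_self (half_pos hδ)) a ha
  have hE₃ := E₃ a ha
  rw [← hNdef] at hE₂ hE₃
  have hsplit : (∫ y in Metric.ball x δ, transitionKernel a φ x y * ρ y)
        - (ρ x + kernelGenerator φ ρ x / (4 * a))
      = ((∫ y in Metric.ball x δ, transitionKernel a φ x y * ρ y)
      - φ x / N * (gaussianAverage a ((Metric.ball x δ).indicator g) x
        - s * gaussianAverage a ((Metric.ball x δ).indicator h) x))
      + φ x / N * ((gaussianAverage a ((Metric.ball x δ).indicator g) x
          - (g x + Δ g x / (4 * a)) * N)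
        - s * (gaussianAverage a ((Metric.ball x δ).indicator h) x - h x * N)) := by
    have hρg : ρ x = φ x * g x := by rw [hgdef]; field_simp
    have hgen : kernelGenerator φ ρ x = φ x * (Δ g x - h x) := rfl
    rw [hgen, hρg, hsdef]
    field_simp
    ring
  rw [hsplit]
  have hb : |(gaussianAverage a ((Metric.ball x δ).indicator g) x
          - (g x + Δ g x / (4 * a)) * N)
        - s * (gaussianAverage a ((Metric.ball x δ).indicator h) x - h x * N)|
      ≤ C₂ / a ^ 2 * N + s * (C₃ / a * N) := by
    refine (abs_sub _ _).trans (add_le_add hE₂ ?_)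
    rw [abs_mul, abs_of_nonneg hs]
    gcongr
  calc _ ≤ φ x * (R * (K * s ^ 2)) + φ x / N * (C₂ / a ^ 2 * N + s * (C₃ / a * N)) := by
        refine (abs_add_le _ _).trans (add_le_add hmain ?_)
        rw [abs_mul, abs_of_pos (div_pos hx hN)]
        gcongr
    _ = _ := by
        rw [hs2, hsdef]
        field_simp
        ring

/-- First-order expansion of the kernel average of a probability density, with an error bound valid
for every `a > 0`. -/
lemma exists_integral_transitionKernel_expansion (hc : Continuous φ) (hpos : ∀ z, 0 < φ z)
    (hint : Integrable fun z => φ z ^ 2) (hφ : ContDiffAt ℝ 4 φ x) (hρ : Integrable ρ)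
    (hρ0 : ∀ y, 0 ≤ ρ y) (hρ1 : ∫ y, ρ y = 1) (hρx : ContDiffAt ℝ 4 ρ x) :
    ∃ C, 0 ≤ C ∧ ∀ a : ℝ, 0 < a →
      |(∫ y, transitionKernel a φ x y * ρ y)
        - (ρ x + kernelGenerator φ ρ x / (4 * a))| ≤ C / a ^ 2 := by
  obtain ⟨δ, hδ, C₁, hC₁, h₁⟩ :=
    exists_setIntegral_transitionKernel_expansion hc hpos hint hφ hρ hρx
  obtain ⟨C₂, hC₂, h₂⟩ := exists_transitionKernel_le hc hpos hint x hδ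
  have hlarge : ∀ᶠ a : ℝ in Filter.atTop, |(∫ y, transitionKernel a φ x y * ρ y)
        - (ρ x + kernelGenerator φ ρ x / (4 * a))| ≤ (C₁ + C₂) / a ^ 2 := by
    filter_upwards [h₁, eventually_exp_neg_mul_le d (c := δ ^ 2 / 4) (by positivity),
      Filter.eventually_gt_atTop 0] with a h₁ hexp ha
    have hi := integrable_transitionKernel_mul hc hpos hint hρ ha x
    have hfar : |∫ y in (Metric.ball x δ)ᶜ, transitionKernel a φ x y * ρ y| ≤ C₂ / a ^ 2 := by
      rw [← integral_indicator measurableSet_ball.compl, ← Real.norm_eq_abs]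
      refine (norm_integral_le_of_norm_le (hρ.const_mul (C₂ * Real.exp (-a * (δ ^ 2 / 4))))
        (.of_forall fun y => ?_)).trans ?_
      · have := hρ0 y
        by_cases hy : y ∈ Metric.ball x δ
        · simp only [hy, Set.mem_compl_iff, not_true_eq_false, Set.indicator_of_notMem,
            not_false_eq_true, norm_zero]
          positivity
        · rw [Set.indicator_of_mem (by exact hy), Real.norm_of_nonneg (mul_nonneg
            (transitionKernel_nonneg hc hpos hint ha y) this)]
          gcongr
          exact (h₂ a ha).2 y hy
      · rw [integral_const_mul, hρ1, mul_one, div_eq_mul_one_div C₂,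
          show -a * (δ ^ 2 / 4) = -(δ ^ 2 / 4) * a by ring]
        exact mul_le_mul_of_nonneg_left hexp.1 hC₂
    rw [← integral_add_compl measurableSet_ball hi, add_div]
    calc _ = |((∫ y in Metric.ball x δ, transitionKernel a φ x y * ρ y)
          - (ρ x + kernelGenerator φ ρ x / (4 * a)))
          + ∫ y in (Metric.ball x δ)ᶜ, transitionKernel a φ x y * ρ y| := by congr 1; ring
      _ ≤ _ := (abs_add_le _ _).trans (add_le_add h₁ hfar)
  obtain ⟨a₀, ha₀⟩ := Filter.eventually_atTop.1 hlarge
  -- for `a ≤ A` every term is bounded by a constant multiple of `(A / a) ^ 2`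
  set A := max a₀ 1
  have hA : 0 < A := one_pos.trans_le (le_max_right _ _)
  set L := |kernelGenerator φ ρ x|
  set C₃ := (C₂ * Real.exp (A * (4 * δ ^ 2)) + ρ x) * A ^ 2 + L * A with hC₃
  have hx := hρ0 x
  have hL : 0 ≤ L := abs_nonneg _
  have hC₃0 : 0 ≤ C₃ := by positivity
  refine ⟨(C₁ + C₂) + C₃, add_nonneg (add_nonneg hC₁ hC₂) hC₃0, fun a ha => ?_⟩
  rcases le_or_gt A a with hAa | hAa
  · exact (ha₀ a ((le_max_left _ _).trans hAa)).trans
      (div_le_div_of_nonneg_right (by linarith) (by positivity))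
  · have hI : |∫ y, transitionKernel a φ x y * ρ y| ≤ C₂ * Real.exp (A * (4 * δ ^ 2)) := by
      rw [← Real.norm_eq_abs]
      refine (norm_integral_le_of_norm_le (hρ.const_mul (C₂ * Real.exp (A * (4 * δ ^ 2))))
        (.of_forall fun y => ?_)).trans_eq (by rw [integral_const_mul, hρ1, mul_one])
      have := hρ0 y
      rw [Real.norm_of_nonneg (mul_nonneg (transitionKernel_nonneg hc hpos hint ha y) this)]
      gcongr
      refine ((h₂ a ha).1 y).trans ?_
      gcongr
    have hLa : |kernelGenerator φ ρ x / (4 * a)| ≤ L / a := by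
      rw [abs_div, abs_of_pos (by positivity : (0 : ℝ) < 4 * a)]
      gcongr
      linarith
    calc |(∫ y, transitionKernel a φ x y * ρ y) - (ρ x + kernelGenerator φ ρ x / (4 * a))|
        ≤ C₂ * Real.exp (A * (4 * δ ^ 2)) + (ρ x + L / a) := by
          refine (abs_sub _ _).trans (add_le_add hI ((abs_add_le _ _).trans (add_le_add ?_ hLa)))
          rw [abs_of_nonneg hx]
      _ ≤ C₃ / a ^ 2 := by
          rw [le_div_iff₀ (by positivity), hC₃]
          have e : (C₂ * Real.exp (A * (4 * δ ^ 2)) + (ρ x + L / a)) * a ^ 2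
              = (C₂ * Real.exp (A * (4 * δ ^ 2)) + ρ x) * a ^ 2 + L * a := by
            field_simp
            ring
          rw [e]
          gcongr
      _ ≤ _ := div_le_div_of_nonneg_right (by linarith) (by positivity)

end Expansion

/-! ### The first-order coefficient -/

section Identities

variable {d : ℕ} {x : EuclideanSpace ℝ (Fin d)}

lemma gradient_apply_eq_fderiv (f : EuclideanSpace ℝ (Fin d) → ℝ) (y : EuclideanSpace ℝ (Fin d))
    (i : Fin d) : ∇ f y i = fderiv ℝ f y (EuclideanSpace.single i 1) := by
  rw [gradient, ← InnerProductSpace.toDual_symm_apply, EuclideanSpace.inner_single_right]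
  simp

lemma inner_gradient_eq_sum (f g : EuclideanSpace ℝ (Fin d) → ℝ) (y : EuclideanSpace ℝ (Fin d)) :
    inner ℝ (∇ f y) (∇ g y) = ∑ i, fderiv ℝ f y (EuclideanSpace.single i 1)
      * fderiv ℝ g y (EuclideanSpace.single i 1) := by
  rw [PiLp.inner_apply]
  refine Finset.sum_congr rfl fun i _ => ?_
  rw [gradient_apply_eq_fderiv, gradient_apply_eq_fderiv]
  simp [mul_comm]

lemma ContDiffAt.differentiableAt_fderiv_apply {f : EuclideanSpace ℝ (Fin d) → ℝ}
    (hf : ContDiffAt ℝ 2 f x) (e : EuclideanSpace ℝ (Fin d)) :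
    DifferentiableAt ℝ (fun y => fderiv ℝ f y e) x :=
  ((hf.fderiv_right (m := 1) (by norm_num)).differentiableAt (by norm_num)).clm_apply
    (differentiableAt_const e)

lemma ContDiffAt.laplacian_eq_sum {f : EuclideanSpace ℝ (Fin d) → ℝ} (hf : ContDiffAt ℝ 2 f x) :
    Δ f x = ∑ i, fderiv ℝ (fun y => fderiv ℝ f y (EuclideanSpace.single i 1)) x
      (EuclideanSpace.single i 1) := by
  rw [laplacian_eq_sum_fderiv_fderiv]
  refine Finset.sum_congr rfl fun i _ => ?_
  rw [fderiv_clm_apply ((hf.fderiv_right (m := 1) (by norm_num)).differentiableAt (by norm_num))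
    (differentiableAt_const _)]
  simp

lemma ContDiffAt.eventually_differentiableAt {f : EuclideanSpace ℝ (Fin d) → ℝ}
    (hf : ContDiffAt ℝ 2 f x) : ∀ᶠ y in nhds x, DifferentiableAt ℝ f y :=
  (hf.eventually (by simp)).mono fun _ h => h.differentiableAt (by norm_num)

/-- Second directional derivative of `r exp (c V)`. -/
lemma fderiv_fderiv_mul_exp {r V : EuclideanSpace ℝ (Fin d) → ℝ} (hr : ContDiffAt ℝ 2 r x)
    (hV : ContDiffAt ℝ 2 V x) (c : ℝ) (e : EuclideanSpace ℝ (Fin d)) :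
    fderiv ℝ (fun y => fderiv ℝ (fun z => r z * Real.exp (c * V z)) y e) x e
      = (fderiv ℝ (fun y => fderiv ℝ r y e) x e + 2 * c * fderiv ℝ r x e * fderiv ℝ V x e
          + c * r x * fderiv ℝ (fun y => fderiv ℝ V y e) x e
          + c ^ 2 * r x * fderiv ℝ V x e ^ 2) * Real.exp (c * V x) := by
  have h1 : (fun y => fderiv ℝ (fun z => r z * Real.exp (c * V z)) y e)
      =ᶠ[nhds x] fun y => (fderiv ℝ r y e + c * (r y * fderiv ℝ V y e)) * Real.exp (c * V y) := by
    filter_upwards [hr.eventually_differentiableAt, hV.eventually_differentiableAt] with y hr hV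
    rw [(hr.hasFDerivAt.fun_mul (hV.hasFDerivAt.const_mul c).exp).fderiv]
    simp
    ring
  have hr0 := (hr.differentiableAt (by norm_num)).hasFDerivAt
  have hV0 := (hV.differentiableAt (by norm_num)).hasFDerivAt
  have hr1 := (hr.differentiableAt_fderiv_apply e).hasFDerivAt
  have hV1 := (hV.differentiableAt_fderiv_apply e).hasFDerivAt
  rw [h1.fderiv_eq,
    ((hr1.fun_add ((hr0.fun_mul hV1).const_mul c)).fun_mul (hV0.const_mul c).exp).fderiv]
  simp
  ring

lemma fderiv_log_apply {r : EuclideanSpace ℝ (Fin d) → ℝ} (hr : DifferentiableAt ℝ r x)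
    (hpos : 0 < r x) (e : EuclideanSpace ℝ (Fin d)) :
    fderiv ℝ (fun z => Real.log (r z)) x e = fderiv ℝ r x e / r x := by
  rw [(hr.hasFDerivAt.log hpos.ne').fderiv]
  simp
  ring

lemma fderiv_fderiv_log {r : EuclideanSpace ℝ (Fin d) → ℝ} (hr : ContDiffAt ℝ 2 r x)
    (hpos : ∀ y, 0 < r y) (e : EuclideanSpace ℝ (Fin d)) :
    fderiv ℝ (fun y => fderiv ℝ (fun z => Real.log (r z)) y e) x e
      = fderiv ℝ (fun y => fderiv ℝ r y e) x e / r x - (fderiv ℝ r x e / r x) ^ 2 := by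
  have h1 : (fun y => fderiv ℝ (fun z => Real.log (r z)) y e)
      =ᶠ[nhds x] fun y => fderiv ℝ r y e * (r y)⁻¹ := by
    filter_upwards [hr.eventually_differentiableAt] with y hr
    rw [fderiv_log_apply hr (hpos y), div_eq_mul_inv]
  have hr0 := (hr.differentiableAt (by norm_num)).hasFDerivAt
  have hr1 := (hr.differentiableAt_fderiv_apply e).hasFDerivAt
  have hx := (hpos x).ne'
  have hinv : HasFDerivAt (fun y => (r y)⁻¹) _ x := (hasDerivAt_inv hx).comp_hasFDerivAt x hr0
  rw [h1.fderiv_eq, (hr1.fun_mul hinv).fderiv]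
  simp
  field_simp
  ring

/-- The right-hand side `∇ · (r ∇V) + β⁻¹ Δ r` of the Fokker-Planck equation at `x`. -/
noncomputable def fokkerPlanckOperator (β : ℝ) (V r : EuclideanSpace ℝ (Fin d) → ℝ)
    (x : EuclideanSpace ℝ (Fin d)) : ℝ :=
  divergence (fun y => r y • ∇ V y) x + β⁻¹ * Δ r x

lemma fokkerPlanckOperator_eq_sum {β : ℝ} {V r : EuclideanSpace ℝ (Fin d) → ℝ}
    (hV : ContDiffAt ℝ 2 V x) (hr : ContDiffAt ℝ 2 r x) :
    fokkerPlanckOperator β V r x = ∑ i, (fderiv ℝ r x (EuclideanSpace.single i 1)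
        * fderiv ℝ V x (EuclideanSpace.single i 1)
      + r x * fderiv ℝ (fun y => fderiv ℝ V y (EuclideanSpace.single i 1)) x
        (EuclideanSpace.single i 1)
      + β⁻¹ * fderiv ℝ (fun y => fderiv ℝ r y (EuclideanSpace.single i 1)) x
        (EuclideanSpace.single i 1)) := by
  rw [fokkerPlanckOperator, divergence, hr.laplacian_eq_sum, Finset.mul_sum,
    ← Finset.sum_add_distrib]
  refine Finset.sum_congr rfl fun i _ => ?_
  congr 1
  simp only [PiLp.smul_apply, smul_eq_mul, gradient_apply_eq_fderiv]
  rw [((hr.differentiableAt (by norm_num)).hasFDerivAt.fun_mul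
    (hV.differentiableAt_fderiv_apply _).hasFDerivAt).fderiv]
  simp
  ring

/-- The first-order coefficient of the kernel average is `β` times the Fokker-Planck operator: the
terms quadratic in `∇V` from `ρ / φ` and from the normalizing factor cancel. -/
lemma kernelGenerator_exp {β : ℝ} (hβ : β ≠ 0) {V r : EuclideanSpace ℝ (Fin d) → ℝ}
    (hV : ContDiffAt ℝ 2 V x) (hr : ContDiffAt ℝ 2 r x) :
    kernelGenerator (fun y => Real.exp (-(β / 2) * V y)) r x
      = β * fokkerPlanckOperator β V r x := by
  have hexp : ∀ c : ℝ, ContDiffAt ℝ 2 (fun y => Real.exp (c * V y)) x := fun c =>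
    (contDiffAt_const.mul hV).exp
  have hg : (fun y => r y / Real.exp (-(β / 2) * V y)) = fun y => r y * Real.exp (β / 2 * V y) := by
    ext y
    rw [neg_mul, Real.exp_neg, div_inv_eq_mul]
  have hφ : ∀ i : Fin d, _ := fun i => fderiv_fderiv_mul_exp (r := fun _ => 1) (x := x)
    contDiffAt_const hV (-(β / 2)) (EuclideanSpace.single i 1)
  simp only [one_mul] at hφ
  rw [kernelGenerator, hg, (hr.mul (hexp _)).laplacian_eq_sum, (hexp _).laplacian_eq_sum,
    fokkerPlanckOperator_eq_sum hV hr, Finset.sum_div, Finset.mul_sum, ← Finset.sum_sub_distrib,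
    Finset.mul_sum, Finset.mul_sum]
  refine Finset.sum_congr rfl fun i _ => ?_
  rw [fderiv_fderiv_mul_exp hr hV, hφ i, neg_mul, Real.exp_neg]
  have h0 := (Real.exp_pos (β / 2 * V x)).ne'
  simp
  field_simp
  ring

lemma fokkerPlanckOperator_eq_potential {β : ℝ} (hβ : β ≠ 0)
    {V r : EuclideanSpace ℝ (Fin d) → ℝ} (hV : ContDiffAt ℝ 2 V x) (hr : ContDiffAt ℝ 2 r x)
    (hpos : ∀ y, 0 < r y) :
    fokkerPlanckOperator β V r x
      = r x * (-β * inner ℝ (∇ (V - densityPotential β r) x) (∇ (densityPotential β r) x)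
        + Δ (V - densityPotential β r) x) := by
  have hx := (hpos x).ne'
  have hlog : ContDiffAt ℝ 2 (fun y => Real.log (r y)) x := hr.log hx
  have hV₀eq : densityPotential β r = (-β⁻¹) • fun y => Real.log (r y) := rfl
  have hV₀ : ContDiffAt ℝ 2 (densityPotential β r) x := contDiffAt_const.mul hlog
  have hd₀ : ∀ e, fderiv ℝ (densityPotential β r) x e = -β⁻¹ * (fderiv ℝ r x e / r x) := by
    intro e
    rw [hV₀eq, fderiv_const_smul (hlog.differentiableAt (by norm_num)),
      ← fderiv_log_apply (hr.differentiableAt (by norm_num)) (hpos x)]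
    rfl
  rw [fokkerPlanckOperator_eq_sum hV hr, hV.laplacian_sub hV₀, hV₀eq,
    InnerProductSpace.laplacian_smul _ hlog, ← hV₀eq, inner_gradient_eq_sum, hV.laplacian_eq_sum,
    hlog.laplacian_eq_sum, smul_eq_mul, Finset.mul_sum, Finset.mul_sum, ← Finset.sum_sub_distrib,
    ← Finset.sum_add_distrib, Finset.mul_sum]
  refine Finset.sum_congr rfl fun i _ => ?_
  rw [fderiv_fderiv_log hr hpos, fderiv_sub (hV.differentiableAt (by norm_num))
    (hV₀.differentiableAt (by norm_num)), sub_apply, hd₀]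
  field_simp
  ring

lemma fokkerPlanckOperator_eq_divergence_log {β : ℝ} (hβ : β ≠ 0)
    {V r : EuclideanSpace ℝ (Fin d) → ℝ} (hV : ContDiffAt ℝ 2 V x) (hr : ContDiffAt ℝ 2 r x)
    (hpos : ∀ y, 0 < r y) (hZ : Integrable fun z => Real.exp (-β * V z)) :
    fokkerPlanckOperator β V r x = β⁻¹ * divergence
      (fun y => r y • ∇ (fun w => Real.log (r w / gibbsDensity β V w)) y) x := by
  have hZ0 : 0 < ∫ z, Real.exp (-β * V z) := integral_exp_pos hZ
  have hlog : (fun w => Real.log (r w / gibbsDensity β V w))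
      = fun w => Real.log (r w) + (β * V w + Real.log (∫ z, Real.exp (-β * V z))) := by
    ext w
    rw [gibbsDensity, Real.log_div (hpos w).ne' (by positivity),
      Real.log_mul (by positivity) (by positivity), Real.log_inv, Real.log_exp]
    ring
  rw [fokkerPlanckOperator_eq_sum hV hr, divergence, Finset.mul_sum, hlog]
  refine Finset.sum_congr rfl fun i _ => ?_
  set e : EuclideanSpace ℝ (Fin d) := EuclideanSpace.single i 1
  have h1 : (fun y => (r y • ∇ (fun w => Real.log (r w)
      + (β * V w + Real.log (∫ z, Real.exp (-β * V z)))) y) i)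
      =ᶠ[nhds x] fun y => fderiv ℝ r y e + β * (r y * fderiv ℝ V y e) := by
    filter_upwards [hr.eventually_differentiableAt, hV.eventually_differentiableAt] with y hr hV
    have hy := (hpos y).ne'
    rw [PiLp.smul_apply, smul_eq_mul, gradient_apply_eq_fderiv,
      ((hr.hasFDerivAt.log hy).fun_add ((hV.hasFDerivAt.const_mul β).add_const _)).fderiv]
    simp
    field_simp
    rfl
  rw [h1.fderiv_eq, ((hr.differentiableAt_fderiv_apply e).hasFDerivAt.fun_add
    (((hr.differentiableAt (by norm_num)).hasFDerivAt.fun_mul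
      (hV.differentiableAt_fderiv_apply e).hasFDerivAt).const_mul β)).fderiv]
  simp
  field_simp
  ring

end Identities

/-! ### The proximal operator -/

section Prox

variable {d : ℕ} {β T : ℝ} {V ρ₀ : EuclideanSpace ℝ (Fin d) → ℝ}

lemma proxWeight_eq (hT : T ≠ 0) (z y : EuclideanSpace ℝ (Fin d)) :
    proxWeight β T V z y
      = Real.exp (-(β / 2) * V z) * Real.exp (-(β / (4 * T)) * ‖z - y‖ ^ 2) := by
  rw [proxWeight, ← Real.exp_add]
  congr 1
  field_simp
  ring

lemma proxIntegrand_eq (hT : T ≠ 0) (x : EuclideanSpace ℝ (Fin d)) :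
    proxIntegrand β T V ρ₀ x
      = fun y => transitionKernel (β / (4 * T)) (fun z => Real.exp (-(β / 2) * V z)) x y * ρ₀ y := by
  ext y
  simp only [proxIntegrand, transitionKernel, gaussianAverage, proxWeight_eq hT]

end Prox

theorem theorem3p2 {d : ℕ} (β : ℝ) (hβ : 0 < β)
    (V ρ₀ : EuclideanSpace ℝ (Fin d) → ℝ)
    (hV : ContDiff ℝ 2 V)
    (hZ : Integrable (fun z => Real.exp (-β * V z)))
    (hρ_pos : ∀ y, 0 < ρ₀ y) (hρ_int : Integrable ρ₀) (hρ_one : ∫ y, ρ₀ y = 1)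
    (x : EuclideanSpace ℝ (Fin d))
    (hVx : ContDiffAt ℝ 4 V x) (hρx : ContDiffAt ℝ 4 ρ₀ x) :
    (∀ T : ℝ, 0 < T →
      (∀ y, Integrable (fun z => proxWeight β T V z y)) ∧
      Integrable (proxIntegrand β T V ρ₀ x)) ∧
    ∃ C : ℝ, ∀ T : ℝ, 0 < T →
      |regWassersteinProx β T V ρ₀ x
        - ρ₀ x * (1 - β * T * inner ℝ (∇ (V - densityPotential β ρ₀) x)
                                      (∇ (densityPotential β ρ₀) x)
                    + T * Δ (V - densityPotential β ρ₀) x)| ≤ C * T ^ 2 ∧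
      |regWassersteinProx β T V ρ₀ x
        - (ρ₀ x + T * (β⁻¹ * divergence
            (fun y => ρ₀ y • ∇ (fun w => Real.log (ρ₀ w / gibbsDensity β V w)) y) x))|
          ≤ C * T ^ 2 ∧
      ∀ (ρ : ℝ → EuclideanSpace ℝ (Fin d) → ℝ) (t₀ : ℝ), ρ t₀ = ρ₀ →
        SatisfiesFokkerPlanckAt β V ρ t₀ x →
        |regWassersteinProx β T V ρ₀ x
          - (ρ₀ x + T * derivWithin (fun t => ρ t x) (Set.Ici t₀) t₀)| ≤ C * T ^ 2 := by
  -- `φ` is the weight `exp (-(β / 2) V)`; it is square-integrable because `φ ^ 2 = exp (-β V)`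
  set φ : EuclideanSpace ℝ (Fin d) → ℝ := fun z => Real.exp (-(β / 2) * V z) with hφdef
  have hc : Continuous φ := by
    have := hV.continuous
    fun_prop
  have hpos : ∀ z, 0 < φ z := fun z => Real.exp_pos _
  have hint : Integrable fun z => φ z ^ 2 := by
    convert hZ using 2 with z
    rw [hφdef, ← Real.exp_nat_mul]
    congr 1
    push_cast
    ring
  have hφx : ContDiffAt ℝ 4 φ x := (contDiffAt_const.mul hVx).exp
  have hV2 : ContDiffAt ℝ 2 V x := hV.contDiffAt
  have hρ2 : ContDiffAt ℝ 2 ρ₀ x := hρx.of_le (by norm_num)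
  have hβ0 := hβ.ne'
  refine ⟨fun T hT => ⟨fun y => ?_, ?_⟩, ?_⟩
  · simp only [proxWeight_eq hT.ne']
    exact integrable_mul_gaussian hc hpos hint (by positivity) y
  · rw [proxIntegrand_eq hT.ne']
    exact integrable_transitionKernel_mul hc hpos hint hρ_int (by positivity) x
  obtain ⟨C, hC, h⟩ := exists_integral_transitionKernel_expansion hc hpos hint hφx hρ_int
    (fun y => (hρ_pos y).le) hρ_one hρx
  have key : ∀ T : ℝ, 0 < T → |regWassersteinProx β T V ρ₀ x
      - (ρ₀ x + T * fokkerPlanckOperator β V ρ₀ x)| ≤ 16 * C / β ^ 2 * T ^ 2 := by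
    intro T hT
    have hT' := h (β / (4 * T)) (by positivity)
    rw [kernelGenerator_exp hβ0 hV2 hρ2] at hT'
    rw [regWassersteinProx, proxIntegrand_eq hT.ne']
    convert hT' using 1
    · congr 3
      field_simp
    · field_simp
      ring
  refine ⟨16 * C / β ^ 2, fun T hT => ⟨?_, ?_, fun ρ t₀ hρ hFP => ?_⟩⟩
  · convert key T hT using 3
    rw [fokkerPlanckOperator_eq_potential hβ0 hV2 hρ2 hρ_pos]
    ring
  · rw [← fokkerPlanckOperator_eq_divergence_log hβ0 hV2 hρ2 hρ_pos hZ]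
    exact key T hT
  · rw [SatisfiesFokkerPlanckAt, hρ] at hFP
    rw [hFP.derivWithin (uniqueDiffOn_Ici t₀ t₀ Set.self_mem_Ici)]
    exact key T hT
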